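/- For $\alpha\in\mathbb R$ let $\mathrm{Comb}_\ell(\mathbb Z,\alpha)$ be the graph whose vertices are the points $(n,x)\in\mathbb Z\times\mathbb Z$ with $0\le x\le \log^{\alpha}(|n|\vee 1)$ (where $\log^\alpha t=(\log t)^\alpha$, with the conventions $0^0=1$ and $0^\alpha=0$ for $\alpha<0$), in which two vertices $(n,x)$, $(m,y)$ are adjacent if and only if either $n=m$ and $|x-y|=1$, or $x=y=0$ and $|n-m|=1$. Let $X=(X_k)_{k\ge0}$, $Y=(Y_k)_{k\ge0}$, $Z=(Z_k)_{k\ge0}$ be independent (discrete-time) simple random walks on $\mathrm{Comb}_\ell(\mathbb Z,\alpha)$, all started at the origin $(0,0)$; at each step a simple random walk moves to a uniformly chosen neighbour of its current vertex. (a) If $\alpha>1$, then almost surely the set $\{k\ge 0: X_k=Y_k=Z_k\}$ is finite; moreover $\mathbb E\,\bigl|\{k\ge 0: X_k=Y_k=Z_k\}\bigr|<\infty$. (b) If $\alpha\le 1$, then almost surely the set $\{k\ge 0: X_k=Y_k=Z_k\}$ is infinite. -/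

import Mathlib

open MeasureTheory ProbabilityTheory
open scoped ENNReal

/-- The full comb `Comb(ℤ, ℤ)`: the square lattice on `ℤ × ℤ` with all horizontal edges removed
except those on the axis with vertical coordinate `0`. -/
def fullComb : SimpleGraph (ℤ × ℤ) where
  Adj v w := (v.1 = w.1 ∧ |v.2 - w.2| = 1) ∨ (v.2 = 0 ∧ w.2 = 0 ∧ |v.1 - w.1| = 1)
  symm := ⟨by
    rintro v w (⟨h1, h2⟩ | ⟨h1, h2, h3⟩)
    · exact Or.inl ⟨h1.symm, by rwa [abs_sub_comm]⟩
    · exact Or.inr ⟨h2, h1, by rwa [abs_sub_comm]⟩⟩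
  loopless := ⟨by
    rintro v (⟨-, h⟩ | ⟨-, -, h⟩) <;> simp at h⟩

/-- The height `log^α (|n| ∨ 1)` at which the tooth at horizontal coordinate `n` is truncated.
For `α > 0` it vanishes if `|n| ≤ 1`. -/
noncomputable def toothHeight (α : ℝ) (n : ℤ) : ℝ :=
  (Real.log (max |(n : ℝ)| 1)) ^ α

/-- The vertices `(n, x)`, with `0 ≤ x ≤ log^α (|n| ∨ 1)`, of the logarithmic comb. -/
def logCombSet (α : ℝ) : Set (ℤ × ℤ) :=
  {v | 0 ≤ v.2 ∧ (v.2 : ℝ) ≤ toothHeight α v.1}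

/-- The vertex type of the logarithmic comb. -/
abbrev LogCombVertex (α : ℝ) : Type := logCombSet α

/-- The logarithmic comb `Comb_ℓ(ℤ, α)`: the full comb restricted to the retained vertices. -/
def logComb (α : ℝ) : SimpleGraph (LogCombVertex α) :=
  fullComb.induce (logCombSet α)

/-- The origin `(0, 0)` of the logarithmic comb. -/
def logCombOrigin (α : ℝ) : LogCombVertex α :=
  ⟨(0, 0), le_refl _, by
    have h : (0 : ℝ) ≤ toothHeight α 0 :=
      Real.rpow_nonneg (Real.log_nonneg (le_max_right _ _)) _
    simpa using h⟩

theorem logComb_neighborSet_finite (α : ℝ) (v : LogCombVertex α) :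
    ((logComb α).neighborSet v).Finite := by
  refine Set.Finite.of_finite_image (f := Subtype.val) ?_ Subtype.val_injective.injOn
  refine ((Set.finite_Icc (v.1.1 - 1) (v.1.1 + 1)).prod
    (Set.finite_Icc (v.1.2 - 1) (v.1.2 + 1))).subset ?_
  rintro _ ⟨w, hw, rfl⟩
  have hw' : fullComb.Adj v.1 w.1 := hw
  simp only [fullComb] at hw'
  simp only [Set.mem_prod, Set.mem_Icc]
  grind

noncomputable instance logCombLocallyFinite (α : ℝ) : (logComb α).LocallyFinite :=
  fun v => (logComb_neighborSet_finite α v).fintype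

open Classical in
/-- The one-step transition probability of simple random walk on a locally finite graph:
`1 / deg v` from `v` to each of its neighbours. -/
noncomputable def srwStep {V : Type*} (G : SimpleGraph V) [G.LocallyFinite] (v w : V) : ℝ≥0∞ :=
  if G.Adj v w then (G.degree v : ℝ≥0∞)⁻¹ else 0

/-- `X` is, under `μ`, a simple random walk on the (countable, locally finite) graph `G` started
at `x₀`: the Markov chain from `x₀` with transition probabilities `srwStep G`. -/
structure IsSimpleRandomWalk {V Ω : Type*} [MeasurableSpace V] [MeasurableSpace Ω]
    (G : SimpleGraph V) [G.LocallyFinite] (μ : Measure Ω) (x₀ : V) (X : ℕ → Ω → V) : Prop where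
  measurable : ∀ n, Measurable (X n)
  start : ∀ᵐ ω ∂μ, X 0 ω = x₀
  step : ∀ (n : ℕ) (x : ℕ → V),
    μ {ω | ∀ i ≤ n + 1, X i ω = x i} =
      μ {ω | ∀ i ≤ n, X i ω = x i} * srwStep G (x n) (x (n + 1))

/-- The set of times at which three trajectories are simultaneously at the same vertex. -/
def tripleCollisions {V Ω : Type*} (X Y Z : ℕ → Ω → V) (ω : Ω) : Set ℕ :=
  {n | X n ω = Y n ω ∧ Y n ω = Z n ω}

/-! Let m(n) be the order of the tooth size at distance n from the origin, and let p_k(x,y) be the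
transition probability divided by the degree of y. By time T = 4^i m(2^i) the walk is spread over
about Q = 2^i m(2^i) vertices, so p_k is of order 1/Q at times k of order T (up to parity). Three
walks meet at such a time with probability of order Q · Q^(-3), so the scale i contributes T / Q² =
1 / m(2^i) expected collisions. As m(2^i) is of order i^α for α ≥ 0 and bounded for α < 0, the total
is finite exactly when α > 1. Finite expectation gives part (a).

Heat kernel bounds. The Dirichlet energy of p_k + p_{k+1} equals the decrement of the on-diagonal
kernel, decrements decrease in time, and effective resistance is at most path length. Hence
`heat_even_self_le`: a set of many vertices near a forces p_{2k}(a,a) to be small. For lower bounds,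
`timeFun` grows by exactly one per step on average, so Markov's inequality confines half of the mass
to distance O(2^i); Cauchy–Schwarz gives the diagonal bound `le_heat_self`, and the energy estimate
extends it to nearby vertices in `exists_le_heat`.

From infinite expectation to infinitely many collisions. Decomposing at the first collision bounds
the expected number of collisions up to time K by the collision probability times the largest
expected number from a diagonal start within reach. `exists_collision_ratio` shows that the two
expectations are comparable, with a ratio δ independent of the starting points. So from every state
of equal parities a collision occurs with probability at least δ. A uniform positive chance on a
closed class forces an almost sure collision (`iInf_stayThenHit_eq_zero`), and the Markov property
at each time T gives infinitely many. -/

namespace SimpleGraph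

/-! ### Averaging, the degree pairing and Dirichlet energy. -/

variable {V : Type*} (G : SimpleGraph V) [G.LocallyFinite]

/-- The average of `F` over the neighbours of a vertex. -/
noncomputable def avg (F : V → ℝ) (x : V) : ℝ :=
  (G.degree x : ℝ)⁻¹ * ∑ y ∈ G.neighborFinset x, F y

/-- Averaging over neighbours, as an operator on finitely supported functions. -/
noncomputable def avgOp : (V →₀ ℝ) →ₗ[ℝ] (V →₀ ℝ) :=
  Finsupp.lsum ℝ fun x => LinearMap.toSpanSingleton ℝ (V →₀ ℝ)
    (∑ y ∈ G.neighborFinset x, Finsupp.single y (G.degree y : ℝ)⁻¹)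

/-- Integration against the degree measure: `f ↦ ∑ x, deg x * f x * F x`. -/
noncomputable def pairing (F : V → ℝ) : (V →₀ ℝ) →ₗ[ℝ] ℝ :=
  Finsupp.lsum ℝ fun x => LinearMap.toSpanSingleton ℝ ℝ (G.degree x * F x)

variable {G}

/-- The average at y of the indicator of x is 1 / deg y when y is adjacent to x, hence the degree of
the target and not of x. -/
theorem avgOp_single (x : V) (r : ℝ) :
    G.avgOp (Finsupp.single x r) =
      r • ∑ y ∈ G.neighborFinset x, Finsupp.single y (G.degree y : ℝ)⁻¹ := by
  simp [avgOp]

theorem pairing_single (F : V → ℝ) (x : V) (r : ℝ) :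
    G.pairing F (Finsupp.single x r) = G.degree x * r * F x := by
  simp [pairing]; ring

theorem avgOp_apply (f : V →₀ ℝ) (y : V) : G.avgOp f y = G.avg f y := by
  classical
  induction f using Finsupp.induction_linear with
  | zero => simp [avg]
  | add f g hf hg => simp [avg, Finset.sum_add_distrib, mul_add] at *; rw [hf, hg]
  | single x r =>
    rw [avgOp_single, avg]
    simp only [Finsupp.smul_apply, Finsupp.finsetSum_apply, Finsupp.single_apply, smul_eq_mul]
    simp [G.adj_comm, mul_comm]

theorem coe_avgOp (f : V →₀ ℝ) : ⇑(G.avgOp f) = G.avg f := funext (avgOp_apply f)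

/-- Reversibility of simple random walk. On a point mass the inverse degrees in `avgOp` cancel the
degrees in the pairing. Only f has finite support, so F may be an unbounded function such as
`timeFun`. -/
theorem pairing_avgOp (F : V → ℝ) (f : V →₀ ℝ) :
    G.pairing F (G.avgOp f) = G.pairing (G.avg F) f := by
  induction f using Finsupp.induction_linear with
  | zero => simp
  | add f g hf hg => simp [hf, hg]
  | single x r =>
    rw [avgOp_single, map_smul, map_sum, pairing_single, avg, smul_eq_mul]
    by_cases hx : G.degree x = 0
    · have : G.neighborFinset x = ∅ := by
        rwa [← Finset.card_eq_zero, G.card_neighborFinset_eq_degree]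
      simp [this]
    have hx' : (G.degree x : ℝ) ≠ 0 := by exact_mod_cast hx
    have h : ∀ y ∈ G.neighborFinset x,
        G.pairing F (Finsupp.single y (G.degree y : ℝ)⁻¹) = F y := by
      intro y hy
      have hy0 : (G.degree y : ℝ) ≠ 0 := by
        have : 0 < G.degree y :=
          (G.degree_pos_iff_exists_adj y).2 ⟨x, by simpa [G.adj_comm] using hy⟩
        exact_mod_cast this.ne'
      rw [pairing_single, mul_inv_cancel₀ hy0, one_mul]
    rw [Finset.sum_congr rfl h]
    field_simp

theorem pairing_eq_sum (F : V → ℝ) (f : V →₀ ℝ) {S : Finset V} (hS : f.support ⊆ S) :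
    G.pairing F f = ∑ x ∈ S, G.degree x * f x * F x := by
  rw [pairing, Finsupp.lsum_apply, Finsupp.sum_of_support_subset f hS _ (by simp)]
  exact Finset.sum_congr rfl fun x _ => by simp; ring

theorem pairing_mono {F F' : V → ℝ} {f : V →₀ ℝ} (hf : ∀ x, 0 ≤ f x) (h : ∀ x, F x ≤ F' x) :
    G.pairing F f ≤ G.pairing F' f := by
  rw [pairing_eq_sum F f subset_rfl, pairing_eq_sum F' f subset_rfl]
  refine Finset.sum_le_sum fun x _ => mul_le_mul_of_nonneg_left (h x) ?_
  exact mul_nonneg (Nat.cast_nonneg _) (hf x)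

theorem pairing_add_left (F F' : V → ℝ) (f : V →₀ ℝ) :
    G.pairing (F + F') f = G.pairing F f + G.pairing F' f := by
  simp only [pairing_eq_sum _ f subset_rfl, ← Finset.sum_add_distrib, Pi.add_apply, mul_add]

theorem pairing_sub_left (F F' : V → ℝ) (f : V →₀ ℝ) :
    G.pairing (F - F') f = G.pairing F f - G.pairing F' f := by
  simp only [pairing_eq_sum _ f subset_rfl, ← Finset.sum_sub_distrib, Pi.sub_apply, mul_sub]

theorem pairing_smul_left (c : ℝ) (F : V → ℝ) (f : V →₀ ℝ) :
    G.pairing (c • F) f = c * G.pairing F f := by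
  simp only [pairing_eq_sum _ f subset_rfl, Finset.mul_sum, Pi.smul_apply, smul_eq_mul]
  exact Finset.sum_congr rfl fun x _ => by ring

theorem pairing_comm (f g : V →₀ ℝ) : G.pairing f g = G.pairing g f := by
  classical
  rw [pairing_eq_sum _ g (Finset.subset_union_right (s₁ := f.support)),
    pairing_eq_sum _ f (Finset.subset_union_left (s₂ := g.support))]
  exact Finset.sum_congr rfl fun x _ => by ring

theorem pairing_self_nonneg (f : V →₀ ℝ) : 0 ≤ G.pairing f f := by
  rw [pairing_eq_sum _ f subset_rfl]
  refine Finset.sum_nonneg fun x _ => ?_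
  rw [mul_assoc]
  exact mul_nonneg (Nat.cast_nonneg _) (mul_self_nonneg _)

theorem pairing_sq_le (f g : V →₀ ℝ) :
    G.pairing f g ^ 2 ≤ G.pairing f f * G.pairing g g := by
  have h : ∀ t : ℝ, 0 ≤ G.pairing g g * (t * t) + (2 * G.pairing f g) * t + G.pairing f f := by
    intro t
    have := pairing_self_nonneg (G := G) (f + t • g)
    rw [Finsupp.coe_add, Finsupp.coe_smul, pairing_add_left, pairing_smul_left, map_add, map_add,
      map_smul, map_smul, smul_eq_mul, smul_eq_mul, pairing_comm g f] at this
    linarith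
  have := discrim_le_zero h
  rw [discrim] at this
  nlinarith

/-- Twice the Dirichlet energy of a finitely supported function, as a sum over oriented edges. -/
theorem two_mul_energy (f : V →₀ ℝ) {S : Finset V} (hf : f.support ⊆ S)
    (hS : ∀ x ∈ f.support, ∀ y, G.Adj x y → y ∈ S) :
    2 * (G.pairing f f - G.pairing f (G.avgOp f)) =
      ∑ x ∈ S, ∑ y ∈ G.neighborFinset x, (f x - f y) ^ 2 := by
  have hsupp : ∀ h : V →₀ ℝ, h.support ⊆ f.support → (G.avgOp h).support ⊆ S := by
    intro h hh y hy
    rw [Finsupp.mem_support_iff, avgOp_apply, avg] at hy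
    obtain ⟨x, hx, hne⟩ := Finset.exists_ne_zero_of_sum_ne_zero (right_ne_zero_of_mul hy)
    exact hS x (hh (by simpa using hne)) y (by simpa [G.adj_comm] using hx)
  have hdeg : ∀ (F : V → ℝ) x, (G.degree x : ℝ) * G.avg F x = ∑ y ∈ G.neighborFinset x, F y := by
    intro F x
    by_cases hx : G.degree x = 0
    · have : G.neighborFinset x = ∅ := by
        rwa [← Finset.card_eq_zero, G.card_neighborFinset_eq_degree]
      simp [this, hx]
    · rw [avg, mul_inv_cancel_left₀ (by exact_mod_cast hx)]
  have h1 : G.pairing f f = ∑ x ∈ S, ∑ y ∈ G.neighborFinset x, f x ^ 2 := by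
    rw [pairing_eq_sum _ f hf]
    refine Finset.sum_congr rfl fun x _ => ?_
    rw [Finset.sum_const, G.card_neighborFinset_eq_degree, nsmul_eq_mul]; ring
  have h2 : G.pairing f (G.avgOp f) = ∑ x ∈ S, ∑ y ∈ G.neighborFinset x, f x * f y := by
    rw [pairing_eq_sum _ _ (hsupp f subset_rfl)]
    refine Finset.sum_congr rfl fun x _ => ?_
    rw [avgOp_apply, hdeg, ← Finset.mul_sum, mul_comm]
  -- The degree measure is stationary: averaging f² over neighbours preserves its integral.
  have h3 : G.pairing f f = ∑ x ∈ S, ∑ y ∈ G.neighborFinset x, f y ^ 2 := by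
    have hs : (f * f).support ⊆ f.support := fun x hx => by
      simp at hx ⊢; exact hx
    have e1 : G.pairing f f = G.pairing (fun _ => 1) (f * f) := by
      rw [pairing_eq_sum _ f subset_rfl, pairing_eq_sum _ (f * f) hs]
      exact Finset.sum_congr rfl fun x _ => by simp; ring
    have e2 : G.pairing (fun _ => 1) (G.avgOp (f * f)) = G.pairing (fun _ => 1) (f * f) := by
      rw [pairing_avgOp, pairing_eq_sum _ (f * f) subset_rfl, pairing_eq_sum _ (f * f) subset_rfl]
      refine Finset.sum_congr rfl fun x _ => ?_
      rw [mul_right_comm, hdeg, Finset.sum_const, G.card_neighborFinset_eq_degree, nsmul_eq_mul]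
      ring
    rw [e1, ← e2, pairing_eq_sum _ _ (hsupp _ hs)]
    refine Finset.sum_congr rfl fun x _ => ?_
    rw [avgOp_apply, hdeg, mul_one]
    exact Finset.sum_congr rfl fun y _ => by simp; ring
  have : ∑ x ∈ S, ∑ y ∈ G.neighborFinset x, (f x - f y) ^ 2 =
      ∑ x ∈ S, ∑ y ∈ G.neighborFinset x, f x ^ 2 + ∑ x ∈ S, ∑ y ∈ G.neighborFinset x, f y ^ 2
        - 2 * ∑ x ∈ S, ∑ y ∈ G.neighborFinset x, f x * f y := by
    simp only [Finset.mul_sum, ← Finset.sum_add_distrib, ← Finset.sum_sub_distrib]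
    exact Finset.sum_congr rfl fun x _ => Finset.sum_congr rfl fun y _ => by ring
  rw [this, ← h1, ← h2, ← h3]; ring

omit [G.LocallyFinite] in
theorem Walk.sum_darts_sub (f : V → ℝ) {v w : V} (p : G.Walk v w) :
    (p.darts.map fun d => f d.fst - f d.snd).sum = f v - f w := by
  induction p with
  | nil => simp
  | cons h p ih => simp [ih]

/-- Effective resistance is at most path length: telescope f along the walk, apply Cauchy–Schwarz,
and bound the squared increments by the sum over all oriented edges, which is twice the energy. -/
theorem sq_sub_le_energy (f : V →₀ ℝ) {v w : V} (p : G.Walk v w) :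
    (f v - f w) ^ 2 ≤ 2 * p.length * (G.pairing f f - G.pairing f (G.avgOp f)) := by
  classical
  -- A path uses each dart at most once, so its increments form a subfamily of the energy sum.
  set q := p.bypass
  have hq : q.IsPath := p.bypass_isPath
  have hnd : q.darts.Nodup := by
    have := hq.isTrail.edges_nodup
    rw [Walk.edges] at this
    exact List.Nodup.of_map _ this
  set S : Finset V := f.support ∪ f.support.biUnion (fun x => G.neighborFinset x) ∪ q.support.toFinset
  have hE := two_mul_energy (G := G) f (S := S)
    (fun x hx => Finset.mem_union_left _ (Finset.mem_union_left _ hx))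
    (fun x hx y hy => Finset.mem_union_left _ (Finset.mem_union_right _
      (Finset.mem_biUnion.2 ⟨x, hx, by simpa using hy⟩)))
  have hsum : f v - f w = ∑ d ∈ q.darts.toFinset, (f d.fst - f d.snd) := by
    rw [List.sum_toFinset _ hnd, Walk.sum_darts_sub]
  have hle : ∑ d ∈ q.darts.toFinset, (f d.fst - f d.snd) ^ 2 ≤
      ∑ x ∈ S, ∑ y ∈ G.neighborFinset x, (f x - f y) ^ 2 := by
    rw [Finset.sum_sigma']
    have hinj : Function.Injective fun d : G.Dart => (⟨d.fst, d.snd⟩ : Σ _ : V, V) := by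
      intro d e h
      simp only [Sigma.mk.injEq, heq_eq_eq] at h
      exact Dart.ext _ _ (Prod.ext h.1 h.2)
    refine (Finset.sum_map q.darts.toFinset ⟨_, hinj⟩
      (fun z : Σ _ : V, V => (f z.1 - f z.2) ^ 2)).symm.trans_le ?_
    refine Finset.sum_le_sum_of_subset_of_nonneg ?_ fun _ _ _ => sq_nonneg _
    intro z hz
    obtain ⟨d, hd, rfl⟩ := Finset.mem_map.1 hz
    refine Finset.mem_sigma.2 ⟨Finset.mem_union_right _ ?_, by simp⟩
    exact List.mem_toFinset.2 (q.dart_fst_mem_support_of_mem_darts (List.mem_toFinset.1 hd))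
  have hcs := sq_sum_le_card_mul_sum_sq (s := q.darts.toFinset) (f := fun d => f d.fst - f d.snd)
  rw [← hsum] at hcs
  have hcard : (q.darts.toFinset.card : ℝ) ≤ p.length := by
    have h1 := List.toFinset_card_le q.darts
    rw [Walk.length_darts] at h1
    exact_mod_cast h1.trans (p.length_bypass_le_length)
  calc (f v - f w) ^ 2 ≤ _ := hcs
    _ ≤ p.length * ∑ x ∈ S, ∑ y ∈ G.neighborFinset x, (f x - f y) ^ 2 := by
      gcongr
    _ = _ := by rw [← hE]; ring

/-! ### The heat kernel on a locally finite graph. -/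

/-- The heat kernel: `heat a k y` is the `k`-step transition probability from `a` to `y` divided
by the degree of `y`. -/
noncomputable def heat (G : SimpleGraph V) [G.LocallyFinite] (a : V) (k : ℕ) : V →₀ ℝ :=
  G.avgOp^[k] (Finsupp.single a (G.degree a : ℝ)⁻¹)

theorem heat_succ (a : V) (k : ℕ) : G.heat a (k + 1) = G.avgOp (G.heat a k) := by
  rw [heat, Function.iterate_succ_apply', heat]

/-- First-step decomposition: `heat_succ` averages over the endpoint, this averages over the
starting point. -/
theorem heat_succ_eq_sum (a : V) (k : ℕ) :
    G.heat a (k + 1) = (G.degree a : ℝ)⁻¹ • ∑ w ∈ G.neighborFinset a, G.heat w k := by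
  induction k with
  | zero => rw [heat_succ, heat, Function.iterate_zero, id, avgOp_single]; rfl
  | succ k ih =>
    rw [heat_succ, ih, map_smul, map_sum]
    simp only [heat_succ]

theorem avg_nonneg {F : V → ℝ} (hF : ∀ x, 0 ≤ F x) (x : V) : 0 ≤ G.avg F x :=
  mul_nonneg (by positivity) (Finset.sum_nonneg fun y _ => hF y)

theorem heat_nonneg (a : V) (k : ℕ) (y : V) : 0 ≤ G.heat a k y := by
  classical
  induction k generalizing y with
  | zero =>
    rw [heat, Function.iterate_zero, id, Finsupp.single_apply]
    split_ifs <;> positivity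
  | succ k ih => rw [heat_succ, avgOp_apply]; exact avg_nonneg ih y

/-- The pairing of F with `heat a k` is the expectation of F at time k for the walk from a. -/
theorem pairing_heat_succ (F : V → ℝ) (a : V) (k : ℕ) :
    G.pairing F (G.heat a (k + 1)) = G.pairing (G.avg F) (G.heat a k) := by
  rw [heat_succ, pairing_avgOp]

theorem pairing_heat_zero (F : V → ℝ) {a : V} (ha : G.degree a ≠ 0) :
    G.pairing F (G.heat a 0) = F a := by
  have : (G.degree a : ℝ) ≠ 0 := by exact_mod_cast ha
  rw [heat, Function.iterate_zero, id, pairing_single, mul_inv_cancel₀ this, one_mul]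

theorem avg_one (hG : ∀ v, G.degree v ≠ 0) : G.avg (fun _ => 1) = fun _ => 1 := by
  funext x
  have : (G.degree x : ℝ) ≠ 0 := by exact_mod_cast hG x
  rw [avg, Finset.sum_const, G.card_neighborFinset_eq_degree, nsmul_eq_mul, mul_one,
    inv_mul_cancel₀ this]

theorem pairing_one_heat (hG : ∀ v, G.degree v ≠ 0) (a : V) (k : ℕ) :
    G.pairing (fun _ => 1) (G.heat a k) = 1 := by
  induction k with
  | zero => exact pairing_heat_zero _ (hG a)
  | succ k ih => rw [pairing_heat_succ, avg_one hG, ih]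

/-- Chapman–Kolmogorov in symmetric form, by shifting one averaging at a time across the pairing. -/
theorem pairing_heat_heat (hG : ∀ v, G.degree v ≠ 0) (a b : V) (j k : ℕ) :
    G.pairing (G.heat b j) (G.heat a k) = G.heat a (j + k) b := by
  induction j generalizing k with
  | zero => rw [pairing_comm, pairing_heat_zero _ (hG b), zero_add]
  | succ j ih => rw [heat_succ b, coe_avgOp, ← pairing_heat_succ, ih]; congr 2; omega

theorem heat_sq_le (hG : ∀ v, G.degree v ≠ 0) (a b : V) (j k : ℕ) :
    G.heat a (j + k) b ^ 2 ≤ G.heat b (2 * j) b * G.heat a (2 * k) a := by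
  have := pairing_sq_le (G := G) (G.heat b j) (G.heat a k)
  rwa [pairing_heat_heat hG, pairing_heat_heat hG, pairing_heat_heat hG, ← two_mul, ← two_mul]
    at this

/-! ### On-diagonal decay on bipartite graphs. -/

section Bipartite

variable {c : V → ZMod 2}

theorem heat_eq_zero_of_parity (hc : ∀ x y, G.Adj x y → c y = c x + 1) (a y : V) (k : ℕ)
    (h : c y ≠ c a + k) : G.heat a k y = 0 := by
  classical
  induction k generalizing y with
  | zero =>
    rw [heat, Function.iterate_zero, id, Finsupp.single_apply, if_neg]
    rintro rfl
    simp at h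
  | succ k ih =>
    rw [heat_succ, avgOp_apply, avg, Finset.sum_eq_zero, mul_zero]
    intro x hx
    have hxy := hc x y (by simpa [G.adj_comm] using hx)
    refine ih x fun hx' => h ?_
    rw [hxy, hx']; push_cast; ring

theorem heat_odd_self (hc : ∀ x y, G.Adj x y → c y = c x + 1) (a : V) (k : ℕ) :
    G.heat a (2 * k + 1) a = 0 := by
  refine heat_eq_zero_of_parity hc a a _ ?_
  have h2 : (2 : ZMod 2) = 0 := rfl
  push_cast
  rw [h2, zero_mul, zero_add]
  simp

variable (hc : ∀ x y, G.Adj x y → c y = c x + 1) (hG : ∀ v, G.degree v ≠ 0)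
include hc hG

/-- Two consecutive times are added because a single heat kernel lives on one colour class and
oscillates. After expansion the odd return terms vanish. -/
theorem energy_heat (a : V) (k : ℕ) :
    G.pairing ⇑(G.heat a k + G.heat a (k + 1)) (G.heat a k + G.heat a (k + 1)) -
      G.pairing ⇑(G.heat a k + G.heat a (k + 1)) (G.avgOp (G.heat a k + G.heat a (k + 1))) =
    G.heat a (2 * k) a - G.heat a (2 * (k + 1)) a := by
  rw [map_add G.avgOp, ← heat_succ, ← heat_succ]
  simp only [Finsupp.coe_add, pairing_add_left, map_add, pairing_heat_heat hG]
  have h1 := heat_odd_self hc a k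
  have h2 := heat_odd_self hc a (k + 1)
  have e1 : k + (k + 1) = 2 * k + 1 := by ring
  have e2 : k + 1 + k = 2 * k + 1 := by ring
  have e3 : k + 1 + (k + 1) = 2 * (k + 1) := by ring
  have e4 : k + (k + 1 + 1) = 2 * (k + 1) := by ring
  have e5 : k + 1 + (k + 1 + 1) = 2 * (k + 1) + 1 := by ring
  rw [e1, e2, e3, e4, e5, h1, h2, ← two_mul]; ring

theorem energy_heat_nonneg (a : V) (k : ℕ) :
    0 ≤ G.heat a (2 * k) a - G.heat a (2 * (k + 1)) a := by
  classical
  rw [← energy_heat hc hG]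
  set f := G.heat a k + G.heat a (k + 1)
  have := two_mul_energy (G := G) f
    (S := f.support ∪ f.support.biUnion (fun x => G.neighborFinset x))
    Finset.subset_union_left
    (fun x hx y hy => Finset.mem_union_right _ (Finset.mem_biUnion.2 ⟨x, hx, by simpa using hy⟩))
  have h2 : 0 ≤ ∑ x ∈ f.support ∪ f.support.biUnion (fun x => G.neighborFinset x),
    ∑ y ∈ G.neighborFinset x, (f x - f y) ^ 2 := by positivity
  linarith

theorem heat_even_antitone (a : V) : Antitone fun k => G.heat a (2 * k) a :=
  antitone_nat_of_succ_le fun k => by linarith [energy_heat_nonneg hc hG a k]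

omit hc in
-- Convexity of even return probabilities: the second difference is the squared norm of p_k −
-- p_{k+2}.
theorem energy_heat_antitone (a : V) :
    Antitone fun k => G.heat a (2 * k) a - G.heat a (2 * (k + 1)) a := by
  refine antitone_nat_of_succ_le fun k => ?_
  have := pairing_self_nonneg (G := G) (G.heat a k - G.heat a (k + 2))
  rw [Finsupp.coe_sub, pairing_sub_left, map_sub, map_sub, pairing_heat_heat hG,
    pairing_heat_heat hG, pairing_heat_heat hG, pairing_heat_heat hG] at this
  have e1 : k + k = 2 * k := by ring
  have e2 : k + (k + 2) = 2 * (k + 1) := by ring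
  have e3 : k + 2 + k = 2 * (k + 1) := by ring
  have e4 : k + 2 + (k + 2) = 2 * (k + 1 + 1) := by ring
  rw [e1, e2, e3, e4] at this
  linarith

omit hc in
-- The decrements telescope to at most p_{2j}(a,a), and each of the k decrements before the
-- displayed one is at least as large.
theorem mul_energy_heat_le (a : V) (j k : ℕ) :
    k * (G.heat a (2 * (j + k)) a - G.heat a (2 * (j + k + 1)) a) ≤ G.heat a (2 * j) a := by
  have h : ∀ i ≤ k, i * (G.heat a (2 * (j + k)) a - G.heat a (2 * (j + k + 1)) a) ≤
      G.heat a (2 * j) a - G.heat a (2 * (j + i)) a := by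
    intro i
    induction i with
    | zero => simp
    | succ i ih =>
      intro hi
      have h1 := ih (by omega)
      have h2 := energy_heat_antitone hG a (show j + i ≤ j + k by omega)
      simp only at h2
      rw [← add_assoc j i 1]
      push_cast
      linarith
  linarith [h k le_rfl, heat_nonneg (G := G) a (2 * (j + k)) a]

theorem sq_sub_heat_le (a : V) (k : ℕ) {v w : V} (p : G.Walk v w) :
    ((G.heat a k v + G.heat a (k + 1) v) - (G.heat a k w + G.heat a (k + 1) w)) ^ 2 ≤
      2 * p.length * (G.heat a (2 * k) a - G.heat a (2 * (k + 1)) a) := by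
  have := sq_sub_le_energy (G.heat a k + G.heat a (k + 1)) p
  rwa [energy_heat hc hG] at this

/-- On-diagonal heat kernel upper bound in terms of a set of given size and radius. -/
theorem heat_even_self_le (a : V) {k r : ℕ} (hk : 0 < k) {B : Finset V} (hB : B.Nonempty)
    (hr : ∀ y ∈ B, ∃ p : G.Walk a y, p.length ≤ r) :
    G.heat a (2 * k) a ≤ 4 / B.card + 8 * r / k := by
  classical
  set f := G.heat a (2 * k) + G.heat a (2 * k + 1)
  have hf : ∀ x, 0 ≤ f x := fun x => add_nonneg (heat_nonneg _ _ _) (heat_nonneg _ _ _)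
  have hcard : (0 : ℝ) < B.card := by exact_mod_cast hB.card_pos
  have hk' : (0 : ℝ) < k := by exact_mod_cast hk
  -- f carries total mass 2, one for each of the two times, and degrees are at least one.
  obtain ⟨y, hy, hfy⟩ : ∃ y ∈ B, f y ≤ 2 / B.card := by
    by_contra! hcon
    have h1 : ∑ y ∈ B, (2 / B.card : ℝ) < ∑ y ∈ B, f y := Finset.sum_lt_sum_of_nonempty hB hcon
    have h2 : ∑ y ∈ B, f y ≤ G.pairing (fun _ => 1) f := by
      rw [pairing_eq_sum _ f (Finset.subset_union_right (s₁ := B))]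
      refine (Finset.sum_le_sum_of_subset_of_nonneg Finset.subset_union_left
        fun y _ _ => hf y).trans (Finset.sum_le_sum fun y _ => ?_)
      have : (1 : ℝ) ≤ G.degree y := by exact_mod_cast Nat.one_le_iff_ne_zero.2 (hG y)
      nlinarith [hf y]
    rw [map_add, pairing_one_heat hG, pairing_one_heat hG] at h2
    rw [Finset.sum_const, nsmul_eq_mul, mul_div_cancel₀ _ hcard.ne'] at h1
    linarith
  obtain ⟨p, hp⟩ := hr y hy
  have h1 := sq_sub_heat_le hc hG a (2 * k) p
  have hfa : G.heat a (2 * k) a + G.heat a (2 * k + 1) a = G.heat a (2 * k) a := by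
    rw [heat_odd_self hc, add_zero]
  have hfy' : G.heat a (2 * k) y + G.heat a (2 * k + 1) y = f y := rfl
  rw [hfa, hfy'] at h1
  have h2 := mul_energy_heat_le hG a k k
  rw [← two_mul k] at h2
  set g := G.heat a (2 * k) a
  set e := G.heat a (2 * (2 * k)) a - G.heat a (2 * (2 * k + 1)) a
  have he : 0 ≤ e := energy_heat_nonneg hc hG a (2 * k)
  have hg : 0 ≤ g := heat_nonneg _ _ _
  have hr0 : (0 : ℝ) ≤ 8 * r / k := by positivity
  have hb0 : (0 : ℝ) ≤ 4 / B.card := by positivity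
  -- Otherwise f drops by at least g / 2 between a and y, so g² / 4 ≤ 2re, while the decrement e at
  -- time 2k is at most g / k.
  by_cases hgB : g ≤ 4 / B.card
  · linarith
  push Not at hgB
  have h3 : g / 2 ≤ g - f y := by
    have : (2 : ℝ) / B.card = (4 / B.card) / 2 := by ring
    linarith
  have h4 : (g / 2) ^ 2 ≤ 2 * r * e := by
    have : (p.length : ℝ) ≤ r := by exact_mod_cast hp
    calc (g / 2) ^ 2 ≤ (g - f y) ^ 2 := by gcongr
      _ ≤ _ := h1
      _ ≤ _ := by gcongr
  have h5 : g ≤ 8 * r / k := by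
    rw [le_div_iff₀ hk']
    have hg' : 0 < g := hb0.trans_lt hgB
    have : g * (g * k) ≤ g * (8 * r) := by
      have hr1 : (0 : ℝ) ≤ r := Nat.cast_nonneg r
      nlinarith [mul_le_mul_of_nonneg_left h2 hr1]
    exact le_of_mul_le_mul_left this hg'
  linarith

end Bipartite

end SimpleGraph

/-! ### Geometry of the comb. -/

/-- The largest vertical coordinate in the tooth at `n`. -/
noncomputable def tipHeight (α : ℝ) (n : ℤ) : ℕ := ⌊toothHeight α n⌋₊

section Geometry

variable {α : ℝ}

theorem toothHeight_nonneg (n : ℤ) : 0 ≤ toothHeight α n :=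
  Real.rpow_nonneg (Real.log_nonneg (le_max_right _ _)) _

theorem mem_logCombSet_iff (v : ℤ × ℤ) :
    v ∈ logCombSet α ↔ 0 ≤ v.2 ∧ v.2 ≤ (tipHeight α v.1 : ℤ) := by
  rw [logCombSet, Set.mem_ofPred_eq, tipHeight, Int.natCast_floor_eq_floor (toothHeight_nonneg _),
    Int.le_floor]

theorem tipHeight_natAbs (n : ℤ) : tipHeight α (n.natAbs : ℤ) = tipHeight α n := by
  simp [tipHeight, toothHeight]

/-- The vertex at height `x` of the tooth at `n`. -/
def combVertex (n : ℤ) (x : ℕ) (hx : x ≤ tipHeight α n) : LogCombVertex α :=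
  ⟨(n, x), (mem_logCombSet_iff _).2 ⟨Int.natCast_nonneg x, Int.ofNat_le.2 hx⟩⟩

theorem exists_eq_combVertex (v : LogCombVertex α) :
    ∃ n x hx, v = combVertex n x hx := by
  obtain ⟨⟨n, x⟩, hv⟩ := v
  obtain ⟨h0, h1⟩ := (mem_logCombSet_iff _).1 hv
  lift x to ℕ using h0
  exact ⟨n, x, Int.ofNat_le.1 h1, rfl⟩

theorem logComb_adj (v w : LogCombVertex α) : (logComb α).Adj v w ↔
    (v.1.1 = w.1.1 ∧ |v.1.2 - w.1.2| = 1) ∨ (v.1.2 = 0 ∧ w.1.2 = 0 ∧ |v.1.1 - w.1.1| = 1) :=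
  Iff.rfl

/-- The two-colouring of the comb. -/
def combParity (v : LogCombVertex α) : ZMod 2 := ((v.1.1 + v.1.2 : ℤ) : ZMod 2)

theorem combParity_adj (v w : LogCombVertex α) (h : (logComb α).Adj v w) :
    combParity w = combParity v + 1 := by
  have key : ∀ a b : ℤ, |a - b| = 1 → ((b : ℤ) : ZMod 2) = (a : ZMod 2) + 1 := by
    intro a b hab
    have h2 : (-1 : ZMod 2) = 1 := rfl
    rcases (abs_eq zero_le_one).1 hab with h | h
    · obtain rfl : b = a + -1 := by omega
      push_cast; rw [h2]
    · obtain rfl : b = a + 1 := by omega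
      push_cast; rfl
  rcases (logComb_adj v w).1 h with ⟨h1, h2⟩ | ⟨h1, h2, h3⟩
  · have := key _ _ h2
    rw [combParity, combParity, Int.cast_add, Int.cast_add, this, h1]; ring
  · have := key _ _ h3
    rw [combParity, combParity, Int.cast_add, Int.cast_add, this, h1, h2]; ring

/-- The summands are the upper, lower and sideways neighbours. Every axis point is a vertex, so only
the upper one depends on the truncation. Taking φ on the ambient lattice avoids membership proofs in
the terms. -/
theorem sum_neighborFinset_logComb (φ : ℤ × ℤ → ℝ) (n : ℤ) (x : ℕ) (hx : x ≤ tipHeight α n) :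
    ∑ w ∈ (logComb α).neighborFinset (combVertex n x hx), φ w.1 =
      (if x + 1 ≤ tipHeight α n then φ (n, x + 1) else 0) + (if 0 < x then φ (n, x - 1) else 0) +
      (if x = 0 then φ (n + 1, 0) + φ (n - 1, 0) else 0) := by
  classical
  set v := combVertex n x hx with hv
  have hmap : ∑ w ∈ (logComb α).neighborFinset v, φ w.1 =
      ∑ z ∈ ((logComb α).neighborFinset v).map ⟨Subtype.val, Subtype.val_injective⟩, φ z := by
    rw [Finset.sum_map]; rfl
  have hset : ((logComb α).neighborFinset v).map ⟨Subtype.val, Subtype.val_injective⟩ =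
      (if x + 1 ≤ tipHeight α n then {(n, (x : ℤ) + 1)} else ∅) ∪
      (if 0 < x then {(n, (x : ℤ) - 1)} else ∅) ∪
      (if x = 0 then {(n + 1, 0), (n - 1, 0)} else ∅) := by
    ext ⟨m, y⟩
    simp only [Finset.mem_map, SimpleGraph.mem_neighborFinset, Function.Embedding.coeFn_mk,
      Finset.mem_union]
    constructor
    · rintro ⟨⟨w, hw⟩, hadj, rfl⟩
      have hw' := (mem_logCombSet_iff _).1 hw
      rw [logComb_adj] at hadj
      simp only [hv, combVertex] at hadj hw'
      rcases hadj with ⟨h1, h2⟩ | ⟨h1, h2, h3⟩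
      · rcases (abs_eq zero_le_one).1 h2 with h | h
        · left; right
          rw [if_pos (by omega)]
          simp; omega
        · left; left
          subst h1
          rw [if_pos (by omega)]
          simp; omega
      · right
        rw [if_pos (by omega)]
        rcases (abs_eq zero_le_one).1 h3 with h | h
        · simp; right; omega
        · simp; left; omega
    · intro h
      have h' : (x + 1 ≤ tipHeight α n ∧ m = n ∧ y = x + 1) ∨ (0 < x ∧ m = n ∧ y = x - 1) ∨
          (x = 0 ∧ (m = n + 1 ∨ m = n - 1) ∧ y = 0) := by
        rcases h with (h | h) | h
        · split_ifs at h with hc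
          · simp only [Finset.mem_singleton, Prod.mk.injEq] at h
            exact Or.inl ⟨hc, h⟩
          · simp at h
        · split_ifs at h with hc
          · simp only [Finset.mem_singleton, Prod.mk.injEq] at h
            exact Or.inr (Or.inl ⟨hc, h⟩)
          · simp at h
        · split_ifs at h with hc
          · simp only [Finset.mem_insert, Finset.mem_singleton, Prod.mk.injEq] at h
            exact Or.inr (Or.inr ⟨hc, by tauto, by tauto⟩)
          · simp at h
      clear h
      have hmem : (m, y) ∈ logCombSet α := by
        rw [mem_logCombSet_iff]
        rcases h' with ⟨h1, rfl, rfl⟩ | ⟨h1, rfl, rfl⟩ | ⟨h1, h2, rfl⟩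
        · exact ⟨by positivity, by simp only; omega⟩
        · exact ⟨by simp only; omega, by simp only; omega⟩
        · exact ⟨le_rfl, Int.natCast_nonneg _⟩
      refine ⟨⟨(m, y), hmem⟩, ?_, rfl⟩
      rw [logComb_adj]
      simp only [hv, combVertex]
      rcases h' with ⟨h1, rfl, rfl⟩ | ⟨h1, rfl, rfl⟩ | ⟨rfl, h2, rfl⟩
      · left; simp
      · left; simp
      · right
        refine ⟨rfl, rfl, ?_⟩
        rcases h2 with rfl | rfl <;> simp
  rw [hmap, hset, Finset.sum_union, Finset.sum_union]
  · congr 1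
    · congr 1 <;> split_ifs <;> simp
    · split_ifs
      · rw [Finset.sum_pair]
        simp; omega
      · simp
  · split_ifs <;> simp
    omega
  · split_ifs <;> simp
    all_goals omega

theorem degree_combVertex (n : ℤ) (x : ℕ) (hx : x ≤ tipHeight α n) :
    ((logComb α).degree (combVertex n x hx) : ℝ) =
      (if x + 1 ≤ tipHeight α n then 1 else 0) + (if 0 < x then 1 else 0) +
      (if x = 0 then 2 else 0) := by
  have := sum_neighborFinset_logComb (fun _ => 1) n x hx
  rw [Finset.sum_const, SimpleGraph.card_neighborFinset_eq_degree, nsmul_eq_mul, mul_one] at this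
  rw [this]; norm_num

theorem logComb_degree_ne_zero (v : LogCombVertex α) : (logComb α).degree v ≠ 0 := by
  obtain ⟨n, x, hx, rfl⟩ := exists_eq_combVertex v
  have := degree_combVertex n x hx
  intro h
  rw [h] at this
  rcases Nat.eq_zero_or_pos x with h0 | h0
  · rw [if_neg (by omega : ¬ 0 < x), if_pos h0] at this
    split_ifs at this <;> norm_num at this
  · rw [if_pos h0, if_neg h0.ne'] at this
    split_ifs at this <;> norm_num at this

theorem logComb_degree_le (v : LogCombVertex α) : ((logComb α).degree v : ℝ) ≤ 3 := by
  obtain ⟨n, x, hx, rfl⟩ := exists_eq_combVertex v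
  rw [degree_combVertex n x hx]
  split_ifs <;> first | omega | norm_num

theorem one_le_logComb_degree (v : LogCombVertex α) : (1 : ℝ) ≤ (logComb α).degree v := by
  exact_mod_cast Nat.one_le_iff_ne_zero.2 (logComb_degree_ne_zero v)

theorem exists_walk_tooth (n : ℤ) (x i : ℕ) (hx : x + i ≤ tipHeight α n) :
    ∃ p : (logComb α).Walk (combVertex n (x + i) hx) (combVertex n x (by omega)), p.length = i := by
  induction i with
  | zero => exact ⟨.nil, rfl⟩
  | succ i ih =>
    obtain ⟨p, hp⟩ := ih (by omega)
    have : (logComb α).Adj (combVertex n (x + (i + 1)) hx) (combVertex n (x + i) (by omega)) := by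
      rw [logComb_adj]
      left
      simp [combVertex]
    exact ⟨.cons this p, by simp [hp]⟩

theorem exists_walk_axis (n : ℤ) (i : ℕ) (s : ℤ) (hs : |s| = 1) :
    ∃ p : (logComb α).Walk (combVertex n 0 (Nat.zero_le _))
      (combVertex (n + s * i) 0 (Nat.zero_le _)), p.length = i := by
  induction i with
  | zero => exact ⟨SimpleGraph.Walk.nil.copy rfl (by simp), by simp⟩
  | succ i ih =>
    obtain ⟨p, hp⟩ := ih
    have : (logComb α).Adj (combVertex (n + s * i) 0 (Nat.zero_le _))
        (combVertex (n + s * (i + 1 : ℕ)) 0 (Nat.zero_le _)) := by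
      rw [logComb_adj]
      right
      simp only [combVertex]
      refine ⟨rfl, rfl, ?_⟩
      push_cast
      rw [show n + s * i - (n + s * ((i : ℤ) + 1)) = -s by ring, abs_neg, hs]
    exact ⟨p.concat this, by simp [hp]⟩

theorem exists_walk_le (n m : ℤ) (x y : ℕ) (hx : x ≤ tipHeight α n) (hy : y ≤ tipHeight α m) :
    ∃ p : (logComb α).Walk (combVertex n x hx) (combVertex m y hy),
      p.length = x + (m - n).natAbs + y := by
  obtain ⟨p, hp⟩ := exists_walk_tooth n 0 x (by simpa using hx)
  obtain ⟨q, hq⟩ := exists_walk_tooth m 0 y (by simpa using hy)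
  obtain ⟨s, hs, hms⟩ : ∃ s : ℤ, |s| = 1 ∧ m = n + s * (m - n).natAbs := by
    rcases le_total n m with h | h
    · exact ⟨1, by simp, by omega⟩
    · exact ⟨-1, by simp, by omega⟩
  obtain ⟨r, hr⟩ := exists_walk_axis (α := α) n (m - n).natAbs s hs
  have hend : combVertex (α := α) (n + s * (m - n).natAbs) 0 (Nat.zero_le _) =
      combVertex m 0 (Nat.zero_le _) := Subtype.ext (Prod.ext hms.symm rfl)
  refine ⟨((p.copy (by simp) rfl).append (r.copy rfl hend)).append
    (q.reverse.copy rfl (by simp)), ?_⟩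
  simp [hp, hq, hr]

end Geometry

/-! ### A function with unit drift. -/

section Martingale

variable (α : ℝ)

/-- The number of vertices at horizontal distance at most `r` from the axis of symmetry. -/
noncomputable def slabCard (r : ℕ) : ℝ :=
  (tipHeight α 0 + 1) + 2 * ∑ j ∈ Finset.range r, ((tipHeight α (j + 1 : ℕ) : ℝ) + 1)

/-- The radial function whose second differences are twice the tooth sizes. -/
noncomputable def radialTime (r : ℕ) : ℝ := ∑ i ∈ Finset.range r, slabCard α i

/-- A function on the comb increasing by exactly one per step on average. -/
noncomputable def timeFun (v : ℤ × ℤ) : ℝ :=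
  radialTime α v.1.natAbs - v.2 * (2 * tipHeight α v.1 - v.2)

theorem radialTime_second_difference (n : ℤ) :
    radialTime α (n + 1).natAbs + radialTime α (n - 1).natAbs =
      2 * radialTime α n.natAbs + 2 * (tipHeight α n + 1) := by
  have hpos : ∀ k : ℕ, radialTime α (k + 2) + radialTime α k =
      2 * radialTime α (k + 1) + 2 * (tipHeight α (k + 1 : ℕ) + 1) := by
    intro k
    simp only [radialTime, Finset.sum_range_succ, slabCard]
    push_cast
    ring
  rcases lt_trichotomy n 0 with h | rfl | h
  · obtain ⟨k, rfl⟩ : ∃ k : ℕ, n = -((k : ℤ) + 1) := ⟨(-n - 1).toNat, by omega⟩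
    have e1 : (-((k : ℤ) + 1) + 1).natAbs = k := by omega
    have e2 : (-((k : ℤ) + 1) - 1).natAbs = k + 2 := by omega
    have e3 : (-((k : ℤ) + 1)).natAbs = k + 1 := by omega
    rw [← tipHeight_natAbs (-((k : ℤ) + 1)), e1, e2, e3, add_comm, hpos]
  · simp [radialTime, slabCard]; ring
  · obtain ⟨k, rfl⟩ : ∃ k : ℕ, n = (k : ℤ) + 1 := ⟨(n - 1).toNat, by omega⟩
    have e1 : ((k : ℤ) + 1 + 1).natAbs = k + 2 := by omega
    have e2 : ((k : ℤ) + 1 - 1).natAbs = k := by omega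
    have e3 : ((k : ℤ) + 1).natAbs = k + 1 := by omega
    rw [← tipHeight_natAbs ((k : ℤ) + 1), e1, e2, e3, hpos]

/-- With h the tip height, −x(2h − x) has second difference 2 and is symmetric about x = h, so it
has unit drift inside the tooth and, by reflection, at the tip. At the base of a nontrivial tooth
the upward neighbour contributes −(2h − 1) and the radial second difference 2(h + 1), which add up
to the degree 3. -/
theorem avg_timeFun (v : LogCombVertex α) :
    (logComb α).avg (fun w => timeFun α w.1) v = timeFun α v.1 + 1 := by
  have hd := one_le_logComb_degree v
  rw [SimpleGraph.avg, inv_mul_eq_iff_eq_mul₀ (by positivity)]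
  obtain ⟨n, x, hx, rfl⟩ := exists_eq_combVertex v
  rw [sum_neighborFinset_logComb (timeFun α), degree_combVertex]
  have h2 := radialTime_second_difference α n
  simp only [timeFun, combVertex]
  rcases Nat.eq_zero_or_pos x with rfl | h0
  · simp only [lt_irrefl, if_false, if_true]
    split_ifs with h
    · push_cast; linarith
    · have : tipHeight α n = 0 := by omega
      rw [this] at h2 ⊢
      push_cast at h2 ⊢; linarith
  · rw [if_pos h0, if_neg h0.ne', if_pos h0, if_neg h0.ne']
    split_ifs with h
    · push_cast; ring
    · have : tipHeight α n = x := by omega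
      rw [this]
      push_cast; ring

/-- This identity at deterministic times replaces exit-time estimates and optional stopping. -/
theorem pairing_timeFun_heat (a : LogCombVertex α) (k : ℕ) :
    (logComb α).pairing (fun w => timeFun α w.1) ((logComb α).heat a k) = timeFun α a.1 + k := by
  induction k with
  | zero => simp [SimpleGraph.pairing_heat_zero _ (logComb_degree_ne_zero a)]
  | succ k ih =>
    have : (logComb α).avg (fun w => timeFun α w.1) = (fun w => timeFun α w.1) + fun _ => 1 :=
      funext (avg_timeFun α)
    rw [SimpleGraph.pairing_heat_succ, this, SimpleGraph.pairing_add_left, ih,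
      SimpleGraph.pairing_one_heat logComb_degree_ne_zero]
    push_cast; ring

end Martingale

/-! ### Tooth profiles. -/

/-- The sizes of the teeth at distance `n` from the origin are comparable to `m n`, where `m` is
nondecreasing, doubling, and grows at most polylogarithmically. -/
structure ToothProfile (α : ℝ) (m : ℕ → ℕ) (D : ℕ) : Prop where
  mono : Monotone m
  one_le : ∀ n, 1 ≤ m n
  le_card : ∀ n : ℤ, m n.natAbs ≤ tipHeight α n + 1
  card_le : ∀ n : ℤ, tipHeight α n + 1 ≤ D * m n.natAbs
  doubling : ∀ n, m (2 * n) ≤ D * m n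
  growth : ∃ C q : ℕ, ∀ i, m (2 ^ i) ≤ C * (i + 1) ^ q

namespace ToothProfile

variable {α : ℝ} {m : ℕ → ℕ} {D : ℕ} (h : ToothProfile α m D)
include h

theorem one_le_const : 1 ≤ D := by
  have := h.card_le 0
  by_contra hD
  obtain rfl : D = 0 := by omega
  omega

theorem card_le_of_le {n : ℤ} {r : ℕ} (hn : n.natAbs ≤ r) : tipHeight α n + 1 ≤ D * m r :=
  (h.card_le n).trans (Nat.mul_le_mul_left _ (h.mono hn))

theorem doubling_pow (e n : ℕ) : m (2 ^ e * n) ≤ D ^ e * m n := by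
  induction e with
  | zero => simp
  | succ e ih =>
    calc m (2 ^ (e + 1) * n) = m (2 * (2 ^ e * n)) := by ring_nf
      _ ≤ D * m (2 ^ e * n) := h.doubling _
      _ ≤ D * (D ^ e * m n) := Nat.mul_le_mul_left _ ih
      _ = _ := by ring

/-- By `growth` the left side is polynomial in i. This makes teeth negligible against the horizontal
scale even at polynomially larger distances. -/
theorem eventually_mul_le_two_pow (K b c : ℕ) :
    ∃ i₀, ∀ i, i₀ ≤ i → K * m (2 ^ (b * i + c)) ≤ 2 ^ i := by
  obtain ⟨C, q, hC⟩ := h.growth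
  have ht := tendsto_pow_const_div_const_pow_of_one_lt q (one_lt_two (α := ℝ))
  set B : ℝ := K * (C * (2 * (b + c + 1)) ^ q) + 1 with hB
  have hB0 : 0 < B := by positivity
  have := (ht.eventually (gt_mem_nhds (inv_pos.2 hB0))).and (Filter.eventually_ge_atTop 1)
  obtain ⟨i₀, hi₀⟩ := Filter.eventually_atTop.1 this
  refine ⟨i₀, fun i hi => ?_⟩
  obtain ⟨h1, h2⟩ := hi₀ i hi
  have h3 : (K * m (2 ^ (b * i + c)) : ℝ) ≤ K * (C * ((b * i + c : ℕ) + 1) ^ q) := by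
    gcongr
    exact_mod_cast hC _
  have h4 : (((b * i + c : ℕ) : ℝ) + 1) ≤ (2 * (b + c + 1)) * i := by
    have : (1 : ℝ) ≤ i := by exact_mod_cast h2
    push_cast
    have hb : (0 : ℝ) ≤ b := Nat.cast_nonneg b
    have hc : (0 : ℝ) ≤ c := Nat.cast_nonneg c
    nlinarith
  have h5 : (K * (C * ((b * i + c : ℕ) + 1) ^ q) : ℝ) ≤ B * i ^ q := by
    have h6 : (((b * i + c : ℕ) : ℝ) + 1) ^ q ≤ (2 * (b + c + 1)) ^ q * i ^ q := by
      rw [← mul_pow]; gcongr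
    calc (K * (C * ((b * i + c : ℕ) + 1) ^ q) : ℝ)
        ≤ K * (C * ((2 * (b + c + 1)) ^ q * i ^ q)) := by gcongr
      _ = (K * (C * (2 * (b + c + 1)) ^ q)) * i ^ q := by ring
      _ ≤ B * i ^ q := by gcongr; rw [hB]; linarith
  have h7 : B * i ^ q ≤ 2 ^ i := by
    rw [inv_eq_one_div, div_lt_div_iff₀ (by positivity) hB0] at h1
    linarith
  exact_mod_cast h3.trans (h5.trans h7)

theorem eventually_mul_le_self (K : ℕ) : ∃ q₀, ∀ q, q₀ ≤ q → K * m q ≤ q := by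
  obtain ⟨i₀, hi₀⟩ := h.eventually_mul_le_two_pow K 1 1
  refine ⟨2 ^ i₀, fun q hq => ?_⟩
  have hq0 : q ≠ 0 := (lt_of_lt_of_le (by positivity) hq).ne'
  have h1 : i₀ ≤ Nat.log 2 q := Nat.le_log_of_pow_le (by norm_num) hq
  calc K * m q ≤ K * m (2 ^ (1 * Nat.log 2 q + 1)) := by
        refine Nat.mul_le_mul_left _ (h.mono ?_)
        rw [one_mul]
        exact (Nat.lt_pow_succ_log_self (by norm_num) q).le
    _ ≤ 2 ^ Nat.log 2 q := hi₀ _ h1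
    _ ≤ q := Nat.pow_log_le_self 2 hq0

end ToothProfile

/-! ### Upper bounds for return probabilities. -/

section HeatUpper

variable {α : ℝ}

/-- The one-dimensional rate k^(-1/2), with no condition on the tooth of a: there are always 2^i
vertices within distance 2 · 2^i, either down its own tooth or along the axis. It covers the scales
at which teeth may be too long for the sharper bound. -/
theorem heat_self_le_of_four_pow_le (a : LogCombVertex α) {k i : ℕ} (hk : 4 ^ i ≤ k) :
    (logComb α).heat a (2 * k) a ≤ 20 / 2 ^ i := by
  classical
  have hk0 : 0 < k := lt_of_lt_of_le (by positivity) hk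
  obtain ⟨B, hB, hr⟩ : ∃ B : Finset (LogCombVertex α), B.card = 2 ^ i ∧
      ∀ y ∈ B, ∃ p : (logComb α).Walk a y, p.length ≤ 2 * 2 ^ i := by
    obtain ⟨n, x, hx, rfl⟩ := exists_eq_combVertex a
    by_cases hxi : 2 ^ i ≤ x
    · refine ⟨(Finset.range (2 ^ i)).image fun j => combVertex n (x - j) (by omega), ?_, ?_⟩
      · rw [Finset.card_image_of_injOn, Finset.card_range]
        intro j hj l hl hjl
        simp only [combVertex, Subtype.mk.injEq, Prod.mk.injEq, true_and, Finset.coe_range,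
          Set.mem_Iio] at hj hl hjl
        omega
      · intro y hy
        obtain ⟨j, hj, rfl⟩ := Finset.mem_image.1 hy
        rw [Finset.mem_range] at hj
        obtain ⟨p, hp⟩ := exists_walk_tooth (α := α) n (x - j) j (by omega)
        exact ⟨p.copy (Subtype.ext (Prod.ext rfl (by simp only [combVertex]; omega))) rfl,
          by rw [SimpleGraph.Walk.length_copy, hp]; omega⟩
    · refine ⟨(Finset.range (2 ^ i)).image fun j : ℕ => combVertex (n + j) 0 (Nat.zero_le _), ?_, ?_⟩
      · rw [Finset.card_image_of_injOn, Finset.card_range]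
        intro j hj l hl hjl
        simp only [combVertex, Subtype.mk.injEq, Prod.mk.injEq, and_true] at hjl
        omega
      · intro y hy
        obtain ⟨j, hj, rfl⟩ := Finset.mem_image.1 hy
        rw [Finset.mem_range] at hj
        obtain ⟨p, hp⟩ := exists_walk_le (α := α) n (n + j) x 0 hx (Nat.zero_le _)
        exact ⟨p, by rw [hp]; omega⟩
  have hne : B.Nonempty := by
    rw [← Finset.card_pos, hB]; positivity
  have := SimpleGraph.heat_even_self_le combParity_adj logComb_degree_ne_zero a hk0 hne hr
  rw [hB] at this
  refine this.trans ?_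
  have h4 : (4 : ℝ) ^ i = 2 ^ i * 2 ^ i := by rw [← mul_pow]; norm_num
  have hk' : (4 : ℝ) ^ i ≤ k := by exact_mod_cast hk
  have h2 : (0 : ℝ) < 2 ^ i := by positivity
  have : (8 * (2 * 2 ^ i : ℕ) : ℝ) / k ≤ 16 / 2 ^ i := by
    push_cast
    rw [div_le_div_iff₀ (by positivity) h2]
    calc (8 * (2 * 2 ^ i) * 2 ^ i : ℝ) = 16 * 4 ^ i := by rw [h4]; ring
      _ ≤ 16 * k := by gcongr
  push_cast at this ⊢
  calc (4 / 2 ^ i + 8 * (2 * 2 ^ i) / k : ℝ) ≤ 4 / 2 ^ i + 16 / 2 ^ i := by gcongr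
    _ = _ := by ring

variable {m : ℕ → ℕ} {D : ℕ}

/-- The test set is a box at horizontal offsets 2^i to 2 · 2^i from a, directed away from the origin
so that all its teeth have size at least m(2^i). Its radius 4 · 2^i allows 2^i down, 2 · 2^i across
and 2^i up. -/
theorem ToothProfile.heat_self_le (h : ToothProfile α m D) (a : LogCombVertex α) {k i : ℕ}
    (ha : tipHeight α a.1.1 ≤ 2 ^ i) (hm : m (2 ^ i) ≤ 2 ^ i) (hk : 4 ^ i * m (2 ^ i) ≤ k) :
    (logComb α).heat a (2 * k) a ≤ 36 / (2 ^ i * m (2 ^ i)) := by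
  classical
  have hm1 := h.one_le (2 ^ i)
  have hk0 : 0 < k := lt_of_lt_of_le (by positivity) hk
  obtain ⟨B, hB, hr⟩ : ∃ B : Finset (LogCombVertex α), B.card = 2 ^ i * m (2 ^ i) ∧
      ∀ y ∈ B, ∃ p : (logComb α).Walk a y, p.length ≤ 4 * 2 ^ i := by
    obtain ⟨n, x, hx, rfl⟩ := exists_eq_combVertex a
    obtain ⟨s, hs⟩ : ∃ s : ℤ, ∀ j : ℕ, (n + s * j).natAbs = n.natAbs + j ∧
        ∀ l : ℕ, n + s * j = n + s * l → j = l := by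
      rcases le_total 0 n with h0 | h0
      · exact ⟨1, fun j => ⟨by omega, fun l => by omega⟩⟩
      · exact ⟨-1, fun j => ⟨by omega, fun l => by omega⟩⟩
    have hmem : ∀ z : Fin (2 ^ i) × Fin (m (2 ^ i)),
        (z.2 : ℕ) ≤ tipHeight α (n + s * ((2 ^ i + z.1 : ℕ) : ℤ)) := by
      intro z
      have h1 := h.le_card (n + s * ((2 ^ i + z.1 : ℕ) : ℤ))
      rw [(hs _).1] at h1
      have h2 := h.mono (show 2 ^ i ≤ n.natAbs + (2 ^ i + z.1) by omega)
      have := z.2.2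
      omega
    refine ⟨Finset.univ.image fun z : Fin (2 ^ i) × Fin (m (2 ^ i)) =>
      combVertex (n + s * ((2 ^ i + z.1 : ℕ) : ℤ)) z.2 (hmem z), ?_, ?_⟩
    · rw [Finset.card_image_of_injective, Finset.card_univ, Fintype.card_prod, Fintype.card_fin,
        Fintype.card_fin]
      rintro ⟨z1, z2⟩ ⟨w1, w2⟩ hzw
      simp only [combVertex, Subtype.mk.injEq, Prod.mk.injEq] at hzw
      have h1 := (hs _).2 _ hzw.1
      have h2 := hzw.2
      ext <;> simp only <;> omega
    · intro y hy
      obtain ⟨z, -, rfl⟩ := Finset.mem_image.1 hy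
      obtain ⟨p, hp⟩ := exists_walk_le (α := α) n _ x z.2 hx (hmem z)
      refine ⟨p, ?_⟩
      have h1 : (n + s * ((2 ^ i + z.1 : ℕ) : ℤ) - n).natAbs ≤ 2 * 2 ^ i := by
        have hs1 : s.natAbs ≤ 1 := by
          have := (hs 1).1
          have h3 := (hs 2).1
          push_cast at this h3
          omega
        rw [add_sub_cancel_left, Int.natAbs_mul, Int.natAbs_natCast]
        calc s.natAbs * (2 ^ i + z.1) ≤ 1 * (2 ^ i + 2 ^ i) :=
              Nat.mul_le_mul hs1 (by omega)
          _ = _ := by ring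
      have h2 : x ≤ 2 ^ i := hx.trans ha
      have h3 := z.2.2
      omega
  have hne : B.Nonempty := by
    rw [← Finset.card_pos, hB]; positivity
  have := SimpleGraph.heat_even_self_le combParity_adj logComb_degree_ne_zero a hk0 hne hr
  rw [hB] at this
  refine this.trans ?_
  have h4 : (4 : ℝ) ^ i = 2 ^ i * 2 ^ i := by rw [← mul_pow]; norm_num
  have hk' : (4 : ℝ) ^ i * m (2 ^ i) ≤ k := by exact_mod_cast hk
  have h2 : (0 : ℝ) < 2 ^ i := by positivity
  have hm' : (0 : ℝ) < m (2 ^ i) := by exact_mod_cast hm1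
  have : (8 * (4 * 2 ^ i : ℕ) : ℝ) / k ≤ 32 / (2 ^ i * m (2 ^ i)) := by
    push_cast
    rw [div_le_div_iff₀ (by positivity) (by positivity)]
    calc (8 * (4 * 2 ^ i) * (2 ^ i * m (2 ^ i)) : ℝ) = 32 * (4 ^ i * m (2 ^ i)) := by rw [h4]; ring
      _ ≤ 32 * k := by gcongr
  push_cast at this ⊢
  calc (4 / (2 ^ i * m (2 ^ i)) + 8 * (4 * 2 ^ i) / k : ℝ)
      ≤ 4 / (2 ^ i * m (2 ^ i)) + 32 / (2 ^ i * m (2 ^ i)) := by gcongr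
    _ = _ := by ring

end HeatUpper

/-! ### Lower bounds for the heat kernel. -/

section HeatLower

variable {α : ℝ} {m : ℕ → ℕ} {D : ℕ}

theorem ToothProfile.le_slabCard (h : ToothProfile α m D) {q r : ℕ} (hq : 2 * q ≤ r) :
    2 * q * m q ≤ slabCard α r := by
  have h1 : ∑ j ∈ Finset.Ico q (2 * q), (m q : ℝ) ≤
      ∑ j ∈ Finset.range r, ((tipHeight α (j + 1 : ℕ) : ℝ) + 1) := by
    calc ∑ j ∈ Finset.Ico q (2 * q), (m q : ℝ)
        ≤ ∑ j ∈ Finset.Ico q (2 * q), ((tipHeight α (j + 1 : ℕ) : ℝ) + 1) := by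
          refine Finset.sum_le_sum fun j hj => ?_
          rw [Finset.mem_Ico] at hj
          have h2 := h.le_card ((j + 1 : ℕ) : ℤ)
          rw [Int.natAbs_natCast] at h2
          have h3 := h.mono (show q ≤ j + 1 by omega)
          exact_mod_cast h3.trans h2
      _ ≤ _ := by
          refine Finset.sum_le_sum_of_subset_of_nonneg ?_ fun _ _ _ => by positivity
          intro j hj
          rw [Finset.mem_Ico] at hj
          rw [Finset.mem_range]; omega
  rw [Finset.sum_const, Nat.card_Ico, nsmul_eq_mul, show 2 * q - q = q by omega] at h1
  rw [slabCard]
  have : (0 : ℝ) ≤ tipHeight α 0 := Nat.cast_nonneg _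
  linarith

theorem slabCard_nonneg (r : ℕ) : 0 ≤ slabCard α r := by
  rw [slabCard]; positivity

theorem ToothProfile.le_radialTime (h : ToothProfile α m D) {q r : ℕ} (hq : 4 * q ≤ r) :
    4 * q ^ 2 * m q ≤ radialTime α r := by
  calc (4 * q ^ 2 * m q : ℝ) = ∑ i ∈ Finset.Ico (2 * q) (4 * q), (2 * q * m q : ℝ) := by
        rw [Finset.sum_const, Nat.card_Ico, nsmul_eq_mul, show 4 * q - 2 * q = 2 * q by omega]
        push_cast; ring
    _ ≤ ∑ i ∈ Finset.Ico (2 * q) (4 * q), slabCard α i :=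
        Finset.sum_le_sum fun i hi => h.le_slabCard (Finset.mem_Ico.1 hi).1
    _ ≤ _ := by
        refine Finset.sum_le_sum_of_subset_of_nonneg ?_ fun _ _ _ => slabCard_nonneg _
        intro j hj
        rw [Finset.mem_Ico] at hj
        rw [Finset.mem_range]; omega

theorem sub_sq_le_timeFun (v : LogCombVertex α) :
    radialTime α v.1.1.natAbs - (tipHeight α v.1.1 : ℝ) ^ 2 ≤ timeFun α v.1 := by
  rw [timeFun]
  nlinarith [sq_nonneg ((tipHeight α v.1.1 : ℝ) - v.1.2)]

/-- `timeFun` is bounded below, and large far away from the origin. -/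
theorem ToothProfile.exists_le_timeFun (h : ToothProfile α m D) :
    ∃ C₀ : ℝ, 0 ≤ C₀ ∧ ∃ q₀ : ℕ, (∀ v : LogCombVertex α, -C₀ ≤ timeFun α v.1) ∧
      ∀ q, q₀ ≤ q → ∀ v : LogCombVertex α, 4 * q ≤ v.1.1.natAbs →
        2 * q ^ 2 * m q ≤ timeFun α v.1 := by
  -- The tooth height is at most D^4 m(q'); its square, the loss in `timeFun`, is then at most q'
  -- m(q') and is absorbed by the radial part.
  obtain ⟨q₀, hq₀⟩ := h.eventually_mul_le_self (D ^ 8)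
  have hD := h.one_le_const
  have hfar : ∀ q, max q₀ 1 ≤ q → ∀ v : LogCombVertex α, 4 * q ≤ v.1.1.natAbs →
      2 * q ^ 2 * m q ≤ timeFun α v.1 := by
    intro q hq v hv
    set q' := v.1.1.natAbs / 4 with hq'
    have hqq : q ≤ q' := by omega
    have h1 := h.le_radialTime (show 4 * q' ≤ v.1.1.natAbs by omega)
    have h2 := sub_sq_le_timeFun v
    have h3 : tipHeight α v.1.1 ≤ D ^ 4 * m q' := by
      have e1 := h.card_le_of_le (show v.1.1.natAbs ≤ 2 ^ 3 * q' by omega)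
      have e2 := Nat.mul_le_mul_left D (h.doubling_pow 3 q')
      calc tipHeight α v.1.1 ≤ D * (D ^ 3 * m q') := by omega
        _ = _ := by ring
    have h4 : (tipHeight α v.1.1) ^ 2 ≤ q' * m q' := by
      calc (tipHeight α v.1.1) ^ 2 ≤ (D ^ 4 * m q') ^ 2 := Nat.pow_le_pow_left h3 2
        _ = (D ^ 8 * m q') * m q' := by ring
        _ ≤ q' * m q' := Nat.mul_le_mul_right _ (hq₀ q' (by omega))
    have h4' : (tipHeight α v.1.1 : ℝ) ^ 2 ≤ q' * m q' := by exact_mod_cast h4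
    have h5 : (1 : ℝ) ≤ q' := by exact_mod_cast (by omega : 1 ≤ q')
    have h6 : (q' * m q' : ℝ) ≤ q' ^ 2 * m q' := by
      gcongr; nlinarith
    have h7 : (2 * q ^ 2 * m q : ℝ) ≤ 2 * q' ^ 2 * m q' := by
      have := h.mono hqq
      gcongr
    have h8 : (0 : ℝ) ≤ q' ^ 2 * m q' := by positivity
    linarith
  refine ⟨((D * m (4 * max q₀ 1) : ℕ) : ℝ) ^ 2, by positivity, max q₀ 1, fun v => ?_, hfar⟩
  rcases le_total (4 * max q₀ 1) v.1.1.natAbs with hv | hv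
  · refine le_trans ?_ (hfar _ le_rfl v hv)
    have : (0 : ℝ) ≤ 2 * ((max q₀ 1 : ℕ) : ℝ) ^ 2 * m (max q₀ 1) := by positivity
    have h' : (0 : ℝ) ≤ ((D * m (4 * max q₀ 1) : ℕ) : ℝ) ^ 2 := by positivity
    linarith
  · refine le_trans ?_ (sub_sq_le_timeFun v)
    have h1 : (tipHeight α v.1.1 : ℝ) ≤ (D * m (4 * max q₀ 1) : ℕ) := by
      have := h.card_le_of_le hv
      exact_mod_cast (by omega : tipHeight α v.1.1 ≤ D * m (4 * max q₀ 1))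
    have h2 : (tipHeight α v.1.1 : ℝ) ^ 2 ≤ ((D * m (4 * max q₀ 1) : ℕ) : ℝ) ^ 2 := by gcongr
    have h3 : 0 ≤ radialTime α v.1.1.natAbs := Finset.sum_nonneg fun _ _ => slabCard_nonneg _
    linarith

/-- Markov's inequality for `timeFun`: with T = 4^i m(2^i), its mean is at most 5T − C₀, whereas it
is at least 128T = 2 (2^(i+3))² m(2^i) outside the slab and at least −C₀ inside. -/
theorem ToothProfile.half_le_mass (h : ToothProfile α m D) (a : LogCombVertex α) :
    ∃ i₀, ∀ i, i₀ ≤ i → ∀ k, k ≤ 4 * (4 ^ i * m (2 ^ i)) →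
      1 / 2 ≤ (logComb α).pairing
        (fun v => if v.1.1.natAbs < 2 ^ (i + 5) then 1 else 0) ((logComb α).heat a k) := by
  obtain ⟨C₀, hC₀, q₀, hlow, hfar⟩ := h.exists_le_timeFun
  obtain ⟨i₁, hi₁⟩ := exists_nat_ge (timeFun α a.1 + C₀)
  refine ⟨max q₀ i₁, fun i hi k hk => ?_⟩
  set u := (logComb α).heat a k
  have hu := SimpleGraph.heat_nonneg (G := logComb α) a k
  set T : ℝ := 4 ^ i * m (2 ^ i) with hT
  have hm1 : (1 : ℝ) ≤ m (2 ^ i) := by exact_mod_cast h.one_le _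
  have hi4 : (i : ℝ) ≤ 4 ^ i := by exact_mod_cast (Nat.lt_pow_self (by norm_num : 1 < 4)).le
  have hTi : (i : ℝ) ≤ T := by nlinarith
  have hT0 : 0 < T := by positivity
  have hkT : (k : ℝ) ≤ 4 * T := by rw [hT]; exact_mod_cast hk
  set ψ : LogCombVertex α → ℝ := fun v => if v.1.1.natAbs < 2 ^ (i + 5) then 1 else 0 with hψ
  have key : (logComb α).pairing ((fun _ => 128 * T) + (-(128 * T + C₀)) • ψ) u ≤
      (logComb α).pairing (fun w => timeFun α w.1) u := by
    refine SimpleGraph.pairing_mono hu fun v => ?_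
    simp only [Pi.add_apply, Pi.smul_apply, hψ, smul_eq_mul]
    split_ifs with hv
    · linarith [hlow v]
    · have hqi : q₀ ≤ 2 ^ (i + 3) :=
        (le_max_left _ _).trans (hi.trans ((Nat.lt_pow_self (by norm_num)).le.trans
          (Nat.pow_le_pow_right (by norm_num) (by omega))))
      have := hfar (2 ^ (i + 3)) hqi v (by
        push Not at hv
        calc 4 * 2 ^ (i + 3) = 2 ^ (i + 5) := by ring
          _ ≤ _ := hv)
      have e1 : (m (2 ^ i) : ℝ) ≤ m (2 ^ (i + 3)) := by
        exact_mod_cast h.mono (Nat.pow_le_pow_right (by norm_num) (by omega))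
      have e2 : 2 * ((2 ^ (i + 3) : ℕ) : ℝ) ^ 2 = 128 * 4 ^ i := by
        push_cast
        rw [show (4 : ℝ) ^ i = 2 ^ i * 2 ^ i by rw [← mul_pow]; norm_num]; ring
      rw [e2] at this
      have e3 : 128 * T ≤ 128 * 4 ^ i * m (2 ^ (i + 3)) := by
        rw [hT, ← mul_assoc]; gcongr
      linarith
  have e1 : (logComb α).pairing (fun _ => 128 * T) u = 128 * T := by
    have : (fun _ : LogCombVertex α => 128 * T) = (128 * T) • fun _ => (1 : ℝ) := by
      funext; simp
    rw [this, SimpleGraph.pairing_smul_left, SimpleGraph.pairing_one_heat logComb_degree_ne_zero,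
      mul_one]
  rw [SimpleGraph.pairing_add_left, e1, SimpleGraph.pairing_smul_left, pairing_timeFun_heat] at key
  have hi1 : (i₁ : ℝ) ≤ i := by exact_mod_cast (le_max_right _ _).trans hi
  by_contra! hlt
  have hp0 : 0 ≤ (logComb α).pairing ψ u := by
    rw [SimpleGraph.pairing_eq_sum _ u subset_rfl]
    refine Finset.sum_nonneg fun v _ => ?_
    have : 0 ≤ ψ v := by simp only [hψ]; split_ifs <;> norm_num
    have := hu v
    positivity
  have hta : -C₀ ≤ timeFun α a.1 := hlow a
  nlinarith

/-- The vertices at horizontal distance less than `R` from the origin fit in a box. -/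
theorem ToothProfile.card_slab_le (h : ToothProfile α m D) {W : Finset (LogCombVertex α)} {R : ℕ}
    (hW : ∀ v ∈ W, v.1.1.natAbs < R) : W.card ≤ 2 * R * (D * m R) := by
  classical
  have h1 : W.map ⟨Subtype.val, Subtype.val_injective⟩ ⊆
      Finset.Ico (-R : ℤ) R ×ˢ Finset.Ico (0 : ℤ) ((D * m R : ℕ) : ℤ) := by
    intro z hz
    obtain ⟨v, hv, rfl⟩ := Finset.mem_map.1 hz
    have h2 := hW v hv
    have h3 := (mem_logCombSet_iff _).1 v.2
    have h4 := h.card_le_of_le h2.le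
    simp only [Function.Embedding.coeFn_mk, Finset.mem_product, Finset.mem_Ico]
    refine ⟨⟨by omega, by omega⟩, h3.1, ?_⟩
    have : ((tipHeight α v.1.1 + 1 : ℕ) : ℤ) ≤ ((D * m R : ℕ) : ℤ) := Int.ofNat_le.2 h4
    push_cast at this ⊢
    linarith [h3.2]
  have h2 := Finset.card_le_card h1
  rw [Finset.card_map, Finset.card_product, Int.card_Ico, Int.card_Ico, sub_zero,
    Int.toNat_natCast, show ((R : ℤ) - -R).toNat = 2 * R by omega] at h2
  exact h2

/-- Cauchy–Schwarz: mass 1/2 sits on at most 64 D^6 · 2^i m(2^i) vertices, and the return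
probability dominates a third of the sum of squared masses since degrees are at most 3; 768 = 4 · 64
· 3. -/
theorem ToothProfile.le_heat_self (h : ToothProfile α m D) (a : LogCombVertex α) :
    ∃ i₀, ∀ i, i₀ ≤ i → ∀ k, k ≤ 4 * (4 ^ i * m (2 ^ i)) →
      (768 * D ^ 6 : ℝ)⁻¹ / (2 ^ i * m (2 ^ i)) ≤ (logComb α).heat a (2 * k) a := by
  obtain ⟨i₀, hi₀⟩ := h.half_le_mass a
  refine ⟨i₀, fun i hi k hk => ?_⟩
  have hmass := hi₀ i hi k hk
  set u := (logComb α).heat a k with hu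
  have hu0 := SimpleGraph.heat_nonneg (G := logComb α) a k
  set W := u.support.filter fun v : LogCombVertex α => v.1.1.natAbs < 2 ^ (i + 5) with hW
  have hsum : (logComb α).pairing
      (fun v => if v.1.1.natAbs < 2 ^ (i + 5) then 1 else 0) u =
      ∑ v ∈ W, (logComb α).degree v * u v := by
    rw [SimpleGraph.pairing_eq_sum _ u subset_rfl, hW, Finset.sum_filter]
    exact Finset.sum_congr rfl fun v _ => by split_ifs <;> simp
  have hg : ∑ v ∈ W, ((logComb α).degree v * u v) ^ 2 ≤ 3 * (logComb α).heat a (2 * k) a := by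
    rw [two_mul k, ← SimpleGraph.pairing_heat_heat logComb_degree_ne_zero,
      SimpleGraph.pairing_eq_sum _ u subset_rfl, Finset.mul_sum]
    calc ∑ v ∈ W, ((logComb α).degree v * u v) ^ 2
        ≤ ∑ v ∈ u.support, ((logComb α).degree v * u v) ^ 2 :=
          Finset.sum_le_sum_of_subset_of_nonneg (Finset.filter_subset _ _)
            fun _ _ _ => sq_nonneg _
      _ ≤ _ := by
          refine Finset.sum_le_sum fun v _ => ?_
          have h1 := logComb_degree_le v
          have h2 := one_le_logComb_degree v
          calc ((logComb α).degree v * u v) ^ 2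
              = (logComb α).degree v * ((logComb α).degree v * u v * u v) := by ring
            _ ≤ 3 * ((logComb α).degree v * u v * u v) := by
                have := hu0 v
                gcongr
  have hcs := sq_sum_le_card_mul_sum_sq (s := W) (f := fun v => (logComb α).degree v * u v)
  rw [← hsum] at hcs
  have hcard : (W.card : ℝ) ≤ 64 * D ^ 6 * (2 ^ i * m (2 ^ i)) := by
    have h1 := h.card_slab_le (W := W) (R := 2 ^ (i + 5)) fun v hv => (Finset.mem_filter.1 hv).2
    have h2 := h.doubling_pow 5 (2 ^ i)
    rw [← pow_add, add_comm 5 i] at h2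
    have h3 : W.card ≤ 64 * D ^ 6 * (2 ^ i * m (2 ^ i)) :=
      calc W.card ≤ 2 * 2 ^ (i + 5) * (D * m (2 ^ (i + 5))) := h1
        _ ≤ 2 * 2 ^ (i + 5) * (D * (D ^ 5 * m (2 ^ i))) := by gcongr
        _ = _ := by ring
    exact_mod_cast h3
  have hm1 : (1 : ℝ) ≤ m (2 ^ i) := by exact_mod_cast h.one_le _
  have hD : (1 : ℝ) ≤ D := by exact_mod_cast h.one_le_const
  set g := (logComb α).heat a (2 * k) a
  have hg0 : 0 ≤ g := SimpleGraph.heat_nonneg _ _ _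
  have h4 : (1 / 2 : ℝ) ^ 2 ≤ 64 * D ^ 6 * (2 ^ i * m (2 ^ i)) * (3 * g) := by
    calc (1 / 2 : ℝ) ^ 2 ≤ _ := pow_le_pow_left₀ (by norm_num) hmass 2
      _ ≤ _ := hcs
      _ ≤ _ := mul_le_mul hcard hg (Finset.sum_nonneg fun _ _ => sq_nonneg _) (by positivity)
  rw [inv_eq_one_div, div_div, div_le_iff₀ (by positivity)]
  linarith

/-- Near-diagonal lower bound for the heat kernel, with constants that do not depend on the
starting point. -/
theorem ToothProfile.exists_le_heat (h : ToothProfile α m D) :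
    ∃ c : ℝ, 0 < c ∧ ∃ e : ℕ, ∀ a : LogCombVertex α, ∃ i₀, e ≤ i₀ ∧ ∀ i, i₀ ≤ i →
      ∀ k, 2 * (4 ^ i * m (2 ^ i)) ≤ k → k < 4 * (4 ^ i * m (2 ^ i)) →
        ∀ v : LogCombVertex α, v.1.1.natAbs ≤ 2 ^ (i - e) →
          c / (2 ^ i * m (2 ^ i)) ≤ (logComb α).heat a k v + (logComb α).heat a (k + 1) v := by
  have hD : (1 : ℝ) ≤ D := by exact_mod_cast h.one_le_const
  set c₀ : ℝ := (768 * D ^ 6 : ℝ)⁻¹ with hc₀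
  have hc0 : 0 < c₀ := by positivity
  -- e is chosen so that over distance 3 · 2^(i-e) the two-step kernel varies by at most half of its
  -- lower bound at a.
  obtain ⟨e, he⟩ := exists_pow_lt_of_lt_one (show (0 : ℝ) < c₀ ^ 2 / 864 by positivity)
    (show (1 / 2 : ℝ) < 1 by norm_num)
  refine ⟨c₀ / 2, by positivity, e, fun a => ?_⟩
  obtain ⟨i₁, hi₁⟩ := h.le_heat_self a
  obtain ⟨i₂, hi₂⟩ := h.eventually_mul_le_two_pow (2 ^ e * D) 1 0
  obtain ⟨L, hL⟩ : ∃ L, L = a.1.1.natAbs + a.1.2.natAbs := ⟨_, rfl⟩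
  refine ⟨max (max i₁ i₂) (L + e), by omega, fun i hi k hk1 hk2 v hv => ?_⟩
  have hei : e ≤ i := by omega
  have hm1 := h.one_le (2 ^ i)
  have hm1' : (1 : ℝ) ≤ m (2 ^ i) := by exact_mod_cast hm1
  set T := 4 ^ i * m (2 ^ i) with hT
  have hT0 : 0 < T := by positivity
  have hsplit : 2 ^ i = 2 ^ e * 2 ^ (i - e) := by rw [← pow_add]; congr 1; omega
  have hDm : D * m (2 ^ i) ≤ 2 ^ (i - e) := by
    have := hi₂ i (by omega)
    rw [one_mul, add_zero, mul_assoc] at this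
    rw [hsplit] at this ⊢
    exact Nat.le_of_mul_le_mul_left this (by positivity)
  have hLi : L ≤ 2 ^ (i - e) := (show L ≤ i - e by omega).trans (Nat.lt_pow_self (by norm_num)).le
  have hie : 2 ^ (i - e) ≤ 2 ^ i := Nat.pow_le_pow_right (by norm_num) (by omega)
  obtain ⟨p, hp⟩ : ∃ p : (logComb α).Walk a v, p.length ≤ 3 * 2 ^ (i - e) := by
    obtain ⟨n, x, hx, rfl⟩ := exists_eq_combVertex a
    obtain ⟨n', y, hy, rfl⟩ := exists_eq_combVertex v
    obtain ⟨p, hp⟩ := exists_walk_le (α := α) n n' x y hx hy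
    refine ⟨p, ?_⟩
    have h1 : tipHeight α n' + 1 ≤ D * m (2 ^ i) :=
      h.card_le_of_le (r := 2 ^ i) (by simp only [combVertex] at hv; omega)
    simp only [combVertex, Int.natAbs_natCast] at hL hv
    omega
  -- One of k and k + 1 is even, and the diagonal bound applies there.
  have hself : c₀ / (2 ^ i * m (2 ^ i)) ≤
      (logComb α).heat a k a + (logComb α).heat a (k + 1) a := by
    rcases Nat.even_or_odd' k with ⟨l, hl | hl⟩
    · have := hi₁ i (by omega) l (by omega)
      rw [hl]
      linarith [SimpleGraph.heat_nonneg (G := logComb α) a (2 * l + 1) a]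
    · have := hi₁ i (by omega) (l + 1) (by omega)
      rw [hl, show 2 * l + 1 + 1 = 2 * (l + 1) by ring]
      linarith [SimpleGraph.heat_nonneg (G := logComb α) a (2 * l + 1) a]
  have hup : (logComb α).heat a (2 * T) a ≤ 36 / (2 ^ i * m (2 ^ i)) := by
    refine h.heat_self_le a ?_ ?_ le_rfl
    · have := h.card_le_of_le (n := a.1.1) (r := 2 ^ i) (by omega)
      omega
    · have := Nat.mul_le_mul_right (m (2 ^ i)) h.one_le_const
      omega
  -- Since l ≥ T, the decrement at time T + l is at most p_{2T}(a,a) / T.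
  obtain ⟨l, rfl⟩ : ∃ l, k = T + l := ⟨k - T, by omega⟩
  have hen := SimpleGraph.mul_energy_heat_le (G := logComb α) logComb_degree_ne_zero a T l
  have hen0 := SimpleGraph.energy_heat_nonneg (G := logComb α) combParity_adj
    logComb_degree_ne_zero a (T + l)
  have hdiff := SimpleGraph.sq_sub_heat_le (G := logComb α) combParity_adj
    logComb_degree_ne_zero a (T + l) p
  set E := (logComb α).heat a (2 * (T + l)) a - (logComb α).heat a (2 * (T + l + 1)) a
  set fa := (logComb α).heat a (T + l) a + (logComb α).heat a (T + l + 1) a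
  set fv := (logComb α).heat a (T + l) v + (logComb α).heat a (T + l + 1) v
  set Q : ℝ := 2 ^ i * m (2 ^ i) with hQ
  have hQ0 : 0 < Q := by positivity
  have hTQ : (T : ℝ) = 2 ^ i * Q := by
    rw [hT, hQ]; push_cast
    rw [show (4 : ℝ) ^ i = 2 ^ i * 2 ^ i by rw [← mul_pow]; norm_num]; ring
  have hE : 2 ^ i * Q * E ≤ 36 / Q := by
    have : (T : ℝ) ≤ l := by exact_mod_cast (by omega : T ≤ l)
    rw [← hTQ]
    calc (T : ℝ) * E ≤ l * E := by gcongr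
      _ ≤ _ := hen
      _ ≤ _ := hup
  have hlen : (p.length : ℝ) ≤ 3 * 2 ^ i * (1 / 2) ^ e := by
    have h1 : (p.length : ℝ) ≤ 3 * 2 ^ (i - e) := by exact_mod_cast hp
    have h2 : (2 : ℝ) ^ i = 2 ^ e * 2 ^ (i - e) := by exact_mod_cast hsplit
    rw [h2]
    refine h1.trans_eq ?_
    rw [one_div, inv_pow]
    field_simp
  have hfin : (fa - fv) ^ 2 ≤ (c₀ / 2 / Q) ^ 2 := by
    calc (fa - fv) ^ 2 ≤ 2 * p.length * E := hdiff
      _ ≤ 2 * (3 * 2 ^ i * (c₀ ^ 2 / 864)) * E := by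
          have : (p.length : ℝ) ≤ 3 * 2 ^ i * (c₀ ^ 2 / 864) := hlen.trans (by gcongr)
          gcongr
      _ = c₀ ^ 2 / 144 / Q * (2 ^ i * Q * E) := by field_simp; ring
      _ ≤ c₀ ^ 2 / 144 / Q * (36 / Q) := by gcongr
      _ = _ := by field_simp; ring
  have habs := abs_le_of_sq_le_sq hfin (by positivity)
  have : c₀ / Q = c₀ / 2 / Q + c₀ / 2 / Q := by ring
  linarith [(le_abs_self (fa - fv)).trans habs]

end HeatLower

/-! ### Triple collision probabilities. -/

namespace SimpleGraph

variable {V : Type*} (G : SimpleGraph V) [G.LocallyFinite]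

/-- The `k`-step transition probability of simple random walk. -/
noncomputable def trans (a : V) (k : ℕ) (v : V) : ℝ≥0∞ :=
  ENNReal.ofReal (G.degree v * G.heat a k v)

/-- The probability that three independent walks started at `a`, `b` and `c` are at the same
vertex at time `k`. -/
noncomputable def tripleMass (a b c : V) (k : ℕ) : ℝ≥0∞ :=
  ∑' v, G.trans a k v * G.trans b k v * G.trans c k v

variable {G}

theorem tsum_trans (hG : ∀ v, G.degree v ≠ 0) (a : V) (k : ℕ) : ∑' v, G.trans a k v = 1 := by
  rw [tsum_eq_sum (s := (G.heat a k).support) (fun v hv => by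
    rw [trans, Finsupp.notMem_support_iff.1 hv]; simp)]
  simp only [trans]
  rw [← ENNReal.ofReal_sum_of_nonneg fun v _ =>
    mul_nonneg (Nat.cast_nonneg _) (heat_nonneg a k v), ← ENNReal.ofReal_one]
  congr 1
  rw [← pairing_one_heat hG a k, pairing_eq_sum _ _ subset_rfl]
  simp

/-- Two of the three factors are bounded uniformly and the third sums to one. -/
theorem tripleMass_self_le (hG : ∀ v, G.degree v ≠ 0) {d : ℝ} (hd : ∀ v, (G.degree v : ℝ) ≤ d)
    {a : V} {k : ℕ} {γ : ℝ} (hγ0 : 0 ≤ γ) (hγ : ∀ v, G.heat a k v ≤ γ) :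
    G.tripleMass a a a k ≤ ENNReal.ofReal ((d * γ) ^ 2) := by
  have h : ∀ v, G.trans a k v ≤ ENNReal.ofReal (d * γ) := fun v =>
    ENNReal.ofReal_le_ofReal (mul_le_mul (hd v) (hγ v) (heat_nonneg _ _ _)
      ((Nat.cast_nonneg _).trans (hd v)))
  have hd0 : 0 ≤ d := (Nat.cast_nonneg _).trans (hd a)
  calc G.tripleMass a a a k
      ≤ ∑' v, ENNReal.ofReal (d * γ) * ENNReal.ofReal (d * γ) * G.trans a k v :=
        ENNReal.tsum_le_tsum fun v => by gcongr <;> exact h v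
    _ = ENNReal.ofReal ((d * γ) ^ 2) := by
        rw [ENNReal.tsum_mul_left, tsum_trans hG, mul_one, ← ENNReal.ofReal_mul (by positivity),
          sq]

end SimpleGraph

/-! ### Expected triple collisions, scale by scale. -/

section Combs

variable {α : ℝ} {m : ℕ → ℕ} {D : ℕ}

/-- Finite speed: on-diagonal bounds are then needed only at reachable vertices, where tooth heights
are controlled. -/
theorem natAbs_le_of_heat_ne_zero (a v : LogCombVertex α) (k : ℕ)
    (h : (logComb α).heat a k v ≠ 0) : v.1.1.natAbs ≤ a.1.1.natAbs + k := by
  classical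
  induction k generalizing v with
  | zero =>
    rw [SimpleGraph.heat, Function.iterate_zero, id, Finsupp.single_apply] at h
    split_ifs at h with hav
    · rw [hav]; omega
    · exact absurd rfl h
  | succ k ih =>
    rw [SimpleGraph.heat_succ, SimpleGraph.avgOp_apply, SimpleGraph.avg] at h
    obtain ⟨x, hx, hne⟩ := Finset.exists_ne_zero_of_sum_ne_zero (right_ne_zero_of_mul h)
    have h1 := ih x hne
    have h2 : (logComb α).Adj v x := by simpa using hx
    rcases (logComb_adj v x).1 h2 with ⟨e, -⟩ | ⟨-, -, e⟩
    · rw [e]; omega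
    · rcases (abs_eq zero_le_one).1 e with e | e <;> omega

/-- Bound for the probability of two consecutive triple collisions in terms of the on-diagonal
heat kernel. -/
theorem tripleMass_add_le (a : LogCombVertex α) (k : ℕ) {γ : ℝ} (hγ0 : 0 ≤ γ)
    (hγ : ∀ v : LogCombVertex α, v.1.1.natAbs ≤ a.1.1.natAbs + (2 * k + 1) →
      (logComb α).heat v (2 * k) v ≤ γ) :
    (logComb α).tripleMass a a a (2 * k) + (logComb α).tripleMass a a a (2 * k + 1) ≤
      ENNReal.ofReal (18 * γ ^ 2) := by
  -- Split the times as 2k = k + k and 2k + 1 = k + (k + 1), and bound off-diagonal by on-diagonal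
  -- values.
  have key : ∀ j, k ≤ j → j ≤ k + 1 → ∀ v, (logComb α).heat a (k + j) v ≤ γ := by
    intro j hj1 hj2 v
    by_cases hne : (logComb α).heat a (k + j) v = 0
    · rw [hne]; exact hγ0
    have h1 := natAbs_le_of_heat_ne_zero a v _ hne
    have h2 := SimpleGraph.heat_sq_le (G := logComb α) logComb_degree_ne_zero a v k j
    have h3 := SimpleGraph.heat_even_antitone (G := logComb α) combParity_adj
      logComb_degree_ne_zero a hj1
    have h4 : (logComb α).heat a (k + j) v ^ 2 ≤ γ ^ 2 := by
      rw [sq γ]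
      refine h2.trans (mul_le_mul (hγ v (by omega)) (h3.trans (hγ a (by omega)))
        (SimpleGraph.heat_nonneg _ _ _) hγ0)
    exact le_of_sq_le_sq h4 hγ0
  have h1 := SimpleGraph.tripleMass_self_le (G := logComb α) logComb_degree_ne_zero
    logComb_degree_le (a := a) (k := 2 * k) hγ0 (by rw [two_mul]; exact key k le_rfl (by omega))
  have h2 := SimpleGraph.tripleMass_self_le (G := logComb α) logComb_degree_ne_zero
    logComb_degree_le (a := a) (k := 2 * k + 1) hγ0
    (by rw [two_mul, add_assoc]; exact key (k + 1) (by omega) le_rfl)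
  refine (add_le_add h1 h2).trans_eq ?_
  rw [← ENNReal.ofReal_add (by positivity) (by positivity)]
  congr 1; ring

theorem sum_range_two_mul {M : Type*} [AddCommMonoid M] (t : ℕ → M) (n : ℕ) :
    ∑ j ∈ Finset.range (2 * n), t j = ∑ k ∈ Finset.range n, (t (2 * k) + t (2 * k + 1)) := by
  induction n with
  | zero => simp
  | succ n ih =>
    rw [show 2 * (n + 1) = 2 * n + 1 + 1 by ring, Finset.sum_range_succ, Finset.sum_range_succ,
      Finset.sum_range_succ, ih, add_assoc]

theorem sum_Ico_le_ofReal {s : ℕ → ℝ≥0∞} {x : ℝ} {p q : ℕ}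
    (hs : ∀ k, p ≤ k → k < q → s k ≤ ENNReal.ofReal x) :
    ∑ k ∈ Finset.Ico p q, s k ≤ ENNReal.ofReal (q * x) := by
  calc ∑ k ∈ Finset.Ico p q, s k ≤ ∑ k ∈ Finset.Ico p q, ENNReal.ofReal x :=
        Finset.sum_le_sum fun k hk => hs k (Finset.mem_Ico.1 hk).1 (Finset.mem_Ico.1 hk).2
    _ = ((q - p : ℕ) : ℝ≥0∞) * ENNReal.ofReal x := by
        rw [Finset.sum_const, Nat.card_Ico, nsmul_eq_mul]
    _ ≤ (q : ℝ≥0∞) * ENNReal.ofReal x := by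
        gcongr; omega
    _ = _ := by
        rw [ENNReal.ofReal_mul (Nat.cast_nonneg _), ENNReal.ofReal_natCast]

/-- At the one-dimensional rate the squared kernel is of order 1/k, so each factor 4 in time costs a
constant: 28800 = 4 · 18 · 20². The bound is uniform in the starting vertex. -/
theorem sum_tripleMass_four_pow_le (a : LogCombVertex α) (j : ℕ) :
    ∑ k ∈ Finset.range (4 ^ j),
      ((logComb α).tripleMass a a a (2 * k) + (logComb α).tripleMass a a a (2 * k + 1)) ≤
      ENNReal.ofReal (18 + 28800 * j) := by
  induction j with
  | zero =>
    rw [pow_zero, Finset.sum_range_one]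
    have := tripleMass_add_le a 0 zero_le_one (fun v _ => by
      rw [mul_zero, SimpleGraph.heat, Function.iterate_zero, id, Finsupp.single_eq_same]
      exact inv_le_one_of_one_le₀ (one_le_logComb_degree v))
    refine this.trans_eq ?_
    norm_num
  | succ j ih =>
    rw [Finset.range_eq_Ico, ← Finset.sum_Ico_consecutive _ (Nat.zero_le (4 ^ j))
      (Nat.pow_le_pow_right (by norm_num) (Nat.le_succ j)), ← Finset.range_eq_Ico]
    have := sum_Ico_le_ofReal (p := 4 ^ j) (q := 4 ^ (j + 1)) (x := 18 * (20 / 2 ^ j) ^ 2)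
      (s := fun k => (logComb α).tripleMass a a a (2 * k) +
        (logComb α).tripleMass a a a (2 * k + 1))
      (fun k hk _ => tripleMass_add_le a k (by positivity)
        fun v _ => heat_self_le_of_four_pow_le v hk)
    refine (add_le_add ih this).trans_eq ?_
    rw [← ENNReal.ofReal_add (by positivity) (by positivity)]
    congr 1
    push_cast
    rw [div_pow, ← pow_mul, mul_comm j 2, pow_mul, pow_succ]
    norm_num
    field_simp
    ring

/-- Upper bound for the expected number of triple collisions of walks started at one vertex, the
teeth being short compared with the scale `2 ^ i₁`. -/
theorem ToothProfile.sum_tripleMass_le (h : ToothProfile α m D) (a : LogCombVertex α) {i₁ n : ℕ}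
    (hi₁ : ∀ i, i₁ ≤ i → m (2 ^ i) ≤ 2 ^ i)
    (ha : ∀ i, i₁ ≤ i → i < n → ∀ v : LogCombVertex α,
      v.1.1.natAbs ≤ a.1.1.natAbs + 2 * (4 ^ (i + 1) * m (2 ^ (i + 1))) →
        tipHeight α v.1.1 ≤ 2 ^ i) :
    ∑ j ∈ Finset.range (2 * (4 ^ n * m (2 ^ n))), (logComb α).tripleMass a a a j ≤
      ENNReal.ofReal (18 + 57600 * i₁ +
        93312 * D * ∑ i ∈ Finset.range n, (m (2 ^ i) : ℝ)⁻¹) := by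
  have hmono : ∀ i l, i ≤ l → 4 ^ i * m (2 ^ i) ≤ 4 ^ l * m (2 ^ l) := fun i l hil =>
    Nat.mul_le_mul (Nat.pow_le_pow_right (by norm_num) hil)
      (h.mono (Nat.pow_le_pow_right (by norm_num) hil))
  set s : ℕ → ℝ≥0∞ := fun k => (logComb α).tripleMass a a a (2 * k) +
    (logComb α).tripleMass a a a (2 * k + 1) with hs
  -- Below scale i₁ the crude bound is used, up to 4^(2 i₁), which exceeds 4^i₁ m(2^i₁).
  have hbase : ∑ k ∈ Finset.range (4 ^ i₁ * m (2 ^ i₁)), s k ≤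
      ENNReal.ofReal (18 + 57600 * i₁) := by
    calc ∑ k ∈ Finset.range (4 ^ i₁ * m (2 ^ i₁)), s k
        ≤ ∑ k ∈ Finset.range (4 ^ (2 * i₁)), s k := by
          refine Finset.sum_le_sum_of_subset (Finset.range_mono ?_)
          calc 4 ^ i₁ * m (2 ^ i₁) ≤ 4 ^ i₁ * 2 ^ i₁ := Nat.mul_le_mul_left _ (hi₁ _ le_rfl)
            _ ≤ 4 ^ i₁ * 4 ^ i₁ := Nat.mul_le_mul_left _ (Nat.pow_le_pow_left (by norm_num) _)
            _ = _ := by rw [← pow_add, two_mul]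
      _ ≤ _ := sum_tripleMass_four_pow_le a (2 * i₁)
      _ = _ := by congr 1; push_cast; ring
  -- Scale i has at most 4 · 4^i D m(2^i) pairs of times, each of cost 18 (36 / (2^i m(2^i)))².
  have hstep : ∀ l, i₁ + l ≤ n → ∑ k ∈ Finset.range (4 ^ (i₁ + l) * m (2 ^ (i₁ + l))), s k ≤
      ENNReal.ofReal (18 + 57600 * i₁ +
        93312 * D * ∑ i ∈ Finset.Ico i₁ (i₁ + l), (m (2 ^ i) : ℝ)⁻¹) := by
    intro l
    induction l with
    | zero => intro _; simpa using hbase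
    | succ l ih =>
      intro hl
      have hm1 : (1 : ℝ) ≤ m (2 ^ (i₁ + l)) := by exact_mod_cast h.one_le _
      rw [Finset.range_eq_Ico, ← Finset.sum_Ico_consecutive _ (Nat.zero_le _)
        (hmono (i₁ + l) (i₁ + (l + 1)) (by omega)), ← Finset.range_eq_Ico, ← add_assoc i₁ l 1,
        Finset.sum_Ico_succ_top (by omega), mul_add, ← add_assoc,
        ENNReal.ofReal_add (by positivity) (by positivity)]
      refine add_le_add (ih (by omega)) ?_
      refine (sum_Ico_le_ofReal (x := 18 * (36 / (2 ^ (i₁ + l) * m (2 ^ (i₁ + l)))) ^ 2)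
        fun k hk1 hk2 => ?_).trans (ENNReal.ofReal_le_ofReal ?_)
      · refine tripleMass_add_le a k (by positivity) fun v hv => ?_
        refine h.heat_self_le v (ha (i₁ + l) (by omega) (by omega) v ?_) (hi₁ _ (by omega)) hk1
        omega
      · have h2 : (m (2 ^ (i₁ + l + 1)) : ℝ) ≤ D * m (2 ^ (i₁ + l)) := by
          have := h.doubling (2 ^ (i₁ + l))
          rw [← pow_succ'] at this
          exact_mod_cast this
        push_cast
        calc (4 ^ (i₁ + l + 1) * m (2 ^ (i₁ + l + 1)) *
              (18 * (36 / (2 ^ (i₁ + l) * m (2 ^ (i₁ + l)))) ^ 2) : ℝ)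
            ≤ 4 ^ (i₁ + l + 1) * (D * m (2 ^ (i₁ + l))) *
              (18 * (36 / (2 ^ (i₁ + l) * m (2 ^ (i₁ + l)))) ^ 2) := by gcongr
          _ = 93312 * D * (m (2 ^ (i₁ + l)) : ℝ)⁻¹ := by
            rw [show (4 : ℝ) ^ (i₁ + l + 1) = 4 * (2 ^ (i₁ + l) * 2 ^ (i₁ + l)) by
              rw [← mul_pow, pow_succ']; norm_num]
            field_simp
            ring
  rw [sum_range_two_mul]
  rcases le_total i₁ n with hn | hn
  · obtain ⟨l, rfl⟩ := Nat.exists_eq_add_of_le hn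
    refine (hstep l le_rfl).trans (ENNReal.ofReal_le_ofReal ?_)
    gcongr
    intro i hi
    exact Finset.mem_range.2 (Finset.mem_Ico.1 hi).2
  · calc ∑ k ∈ Finset.range (4 ^ n * m (2 ^ n)), s k
        ≤ ∑ k ∈ Finset.range (4 ^ i₁ * m (2 ^ i₁)), s k :=
          Finset.sum_le_sum_of_subset (Finset.range_mono (hmono _ _ hn))
      _ ≤ _ := hbase
      _ ≤ _ := ENNReal.ofReal_le_ofReal (le_add_of_nonneg_right (by positivity))

/-- A box of order Q = 2^i m(2^i) vertices lies in the near-diagonal range of all three walks, and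
each of its vertices contributes order Q^(-3). The threshold i₀ depends on the starting points but
c₁ does not. -/
theorem ToothProfile.exists_le_tripleMass (h : ToothProfile α m D) :
    ∃ c₁ : ℝ, 0 < c₁ ∧ ∀ a b c : LogCombVertex α, combParity a = combParity b →
      combParity b = combParity c → ∃ i₀, ∀ i, i₀ ≤ i →
      ∀ k, 2 * (4 ^ i * m (2 ^ i)) ≤ k → k < 4 * (4 ^ i * m (2 ^ i)) →
        ENNReal.ofReal (c₁ / (4 ^ i * m (2 ^ i) ^ 2)) ≤
          (logComb α).tripleMass a b c k + (logComb α).tripleMass a b c (k + 1) := by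
  classical
  obtain ⟨c₀, hc₀, e, hlow⟩ := h.exists_le_heat
  have hD : (1 : ℝ) ≤ D := by exact_mod_cast h.one_le_const
  refine ⟨c₀ ^ 3 / (2 * D) ^ (e + 1), by positivity, fun a b c hab hbc => ?_⟩
  obtain ⟨i₁, hi₁, ha⟩ := hlow a
  obtain ⟨i₂, hi₂, hb⟩ := hlow b
  obtain ⟨i₃, hi₃, hc⟩ := hlow c
  refine ⟨max (max i₁ i₂) i₃ + 1, fun i hi k hk1 hk2 => ?_⟩
  obtain ⟨r, hr⟩ : ∃ r, i = r + (e + 1) := ⟨i - (e + 1), by omega⟩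
  have hm1 : (1 : ℝ) ≤ m (2 ^ i) := by exact_mod_cast h.one_le _
  set q : ℝ := c₀ / (2 ^ i * m (2 ^ i)) with hq
  have hq0 : 0 < q := by positivity
  have hpt : ∀ v : LogCombVertex α, v.1.1.natAbs ≤ 2 ^ (i - e) → ENNReal.ofReal (q ^ 3) ≤
      (logComb α).trans a k v * (logComb α).trans b k v * (logComb α).trans c k v +
      (logComb α).trans a (k + 1) v * (logComb α).trans b (k + 1) v *
        (logComb α).trans c (k + 1) v := by
    intro v hv
    have hva := ha i (by omega) k hk1 hk2 v hv
    have hvb := hb i (by omega) k hk1 hk2 v hv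
    have hvc := hc i (by omega) k hk1 hk2 v hv
    have htr : ∀ (x : LogCombVertex α) j, q ≤ (logComb α).heat x j v →
        ENNReal.ofReal q ≤ (logComb α).trans x j v := fun x j hx =>
      ENNReal.ofReal_le_ofReal (hx.trans (le_mul_of_one_le_left
        (SimpleGraph.heat_nonneg _ _ _) (one_le_logComb_degree v)))
    have hq3 : ENNReal.ofReal (q ^ 3) =
        ENNReal.ofReal q * ENNReal.ofReal q * ENNReal.ofReal q := by
      rw [← ENNReal.ofReal_mul hq0.le, ← ENNReal.ofReal_mul (by positivity)]; congr 1; ring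
    rw [hq3]
    -- Starting parities agree, so all three kernels at v vanish at the same one of the times k and
    -- k + 1, and the other time carries the whole lower bound.
    by_cases hpar : combParity v = combParity a + k
    · have hz : ∀ x : LogCombVertex α, combParity x = combParity a →
          (logComb α).heat x (k + 1) v = 0 := fun x hx =>
        SimpleGraph.heat_eq_zero_of_parity combParity_adj x v (k + 1) (by
          rw [hpar, hx]; push_cast; rw [← add_assoc]; simp)
      rw [hz a rfl, add_zero] at hva
      rw [hz b hab.symm, add_zero] at hvb
      rw [hz c (hbc.symm.trans hab.symm), add_zero] at hvc
      exact le_add_right (mul_le_mul' (mul_le_mul' (htr _ _ hva) (htr _ _ hvb)) (htr _ _ hvc))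
    · have hz : ∀ x : LogCombVertex α, combParity x = combParity a →
          (logComb α).heat x k v = 0 := fun x hx =>
        SimpleGraph.heat_eq_zero_of_parity combParity_adj x v k (by rwa [hx])
      rw [hz a rfl, zero_add] at hva
      rw [hz b hab.symm, zero_add] at hvb
      rw [hz c (hbc.symm.trans hab.symm), zero_add] at hvc
      exact le_add_left (mul_le_mul' (mul_le_mul' (htr _ _ hva) (htr _ _ hvb)) (htr _ _ hvc))
  have hmem : ∀ z : Fin (2 ^ r) × Fin (m (2 ^ r)),
      (z.2 : ℕ) ≤ tipHeight α ((2 ^ r + z.1 : ℕ) : ℤ) := by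
    intro z
    have h1 := h.le_card ((2 ^ r + z.1 : ℕ) : ℤ)
    rw [Int.natAbs_natCast] at h1
    have h2 := h.mono (show 2 ^ r ≤ 2 ^ r + (z.1 : ℕ) by omega)
    have := z.2.2
    omega
  set W : Finset (LogCombVertex α) := Finset.univ.image fun z : Fin (2 ^ r) × Fin (m (2 ^ r)) =>
    combVertex ((2 ^ r + z.1 : ℕ) : ℤ) z.2 (hmem z) with hW
  have hcard : W.card = 2 ^ r * m (2 ^ r) := by
    rw [Finset.card_image_of_injective, Finset.card_univ, Fintype.card_prod, Fintype.card_fin,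
      Fintype.card_fin]
    rintro ⟨z1, z2⟩ ⟨w1, w2⟩ hzw
    simp only [combVertex, Subtype.mk.injEq, Prod.mk.injEq] at hzw
    ext <;> simp only <;> omega
  have hWle : ∀ v ∈ W, v.1.1.natAbs ≤ 2 ^ (i - e) := by
    intro v hv
    obtain ⟨z, -, rfl⟩ := Finset.mem_image.1 hv
    simp only [combVertex, Int.natAbs_natCast]
    have := z.1.2
    rw [hr, show r + (e + 1) - e = r + 1 by omega, pow_succ]
    omega
  calc ENNReal.ofReal (c₀ ^ 3 / (2 * D) ^ (e + 1) / (4 ^ i * m (2 ^ i) ^ 2))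
      ≤ ENNReal.ofReal (W.card * q ^ 3) := by
        refine ENNReal.ofReal_le_ofReal ?_
        have h1 : (m (2 ^ i) : ℝ) ≤ D ^ (e + 1) * m (2 ^ r) := by
          have := h.doubling_pow (e + 1) (2 ^ r)
          rw [← pow_add, add_comm, ← hr] at this
          exact_mod_cast this
        have h2 : (2 : ℝ) ^ i = 2 ^ r * 2 ^ (e + 1) := by rw [← pow_add, hr]
        have h3 : (2 ^ i * m (2 ^ i) / (2 * D) ^ (e + 1) : ℝ) ≤ W.card := by
          rw [hcard, div_le_iff₀ (by positivity), mul_pow]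
          push_cast
          calc (2 ^ i * m (2 ^ i) : ℝ) ≤ 2 ^ r * 2 ^ (e + 1) * (D ^ (e + 1) * m (2 ^ r)) := by
                rw [h2]; gcongr
            _ = _ := by ring
        calc c₀ ^ 3 / (2 * D) ^ (e + 1) / (4 ^ i * m (2 ^ i) ^ 2)
            = 2 ^ i * m (2 ^ i) / (2 * D) ^ (e + 1) * q ^ 3 := by
              rw [hq, show (4 : ℝ) ^ i = 2 ^ i * 2 ^ i by rw [← mul_pow]; norm_num]
              field_simp
          _ ≤ _ := by gcongr
    _ = ∑ v ∈ W, ENNReal.ofReal (q ^ 3) := by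
        rw [Finset.sum_const, nsmul_eq_mul, ENNReal.ofReal_mul (Nat.cast_nonneg _),
          ENNReal.ofReal_natCast]
    _ ≤ ∑ v ∈ W, _ := Finset.sum_le_sum fun v hv => hpt v (hWle v hv)
    _ ≤ ∑' v, _ := ENNReal.sum_le_tsum W
    _ = _ := ENNReal.tsum_add

/-- With T = 4^i m(2^i), the windows [2T, 4T) of distinct scales are disjoint because 4T is at most
the T of the next scale. Each contributes a multiple of 1 / m(2^i). -/
theorem ToothProfile.exists_le_sum_tripleMass (h : ToothProfile α m D) :
    ∃ c₂ : ℝ, 0 < c₂ ∧ ∀ a b c : LogCombVertex α, combParity a = combParity b →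
      combParity b = combParity c → ∃ i₀, ∀ n, i₀ ≤ n →
        ENNReal.ofReal (c₂ * ∑ i ∈ Finset.Ico i₀ n, (m (2 ^ i) : ℝ)⁻¹) ≤
          ∑ j ∈ Finset.range (4 ^ n * m (2 ^ n) + 1), (logComb α).tripleMass a b c j := by
  obtain ⟨c₁, hc₁, hlow⟩ := h.exists_le_tripleMass
  refine ⟨c₁, hc₁, fun a b c hab hbc => ?_⟩
  obtain ⟨i₀, hi₀⟩ := hlow a b c hab hbc
  refine ⟨i₀, fun n hn => ?_⟩
  set t := (logComb α).tripleMass a b c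
  have hstep : ∀ n, i₀ ≤ n → ENNReal.ofReal (2 * c₁ * ∑ i ∈ Finset.Ico i₀ n, (m (2 ^ i) : ℝ)⁻¹) ≤
      ∑ k ∈ Finset.range (4 ^ n * m (2 ^ n)), (t k + t (k + 1)) := by
    intro n hn
    induction n, hn using Nat.le_induction with
    | base => simp
    | succ n hn ih =>
      have hm1 : (1 : ℝ) ≤ m (2 ^ n) := by exact_mod_cast h.one_le _
      have hT : 4 * (4 ^ n * m (2 ^ n)) ≤ 4 ^ (n + 1) * m (2 ^ (n + 1)) := by
        rw [pow_succ', mul_assoc]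
        gcongr
        exact h.mono (Nat.pow_le_pow_right (by norm_num) (by omega))
      set T := 4 ^ n * m (2 ^ n) with hTdef
      rw [Finset.sum_Ico_succ_top hn, mul_add, ENNReal.ofReal_add (by positivity) (by positivity)]
      calc _ ≤ ∑ k ∈ Finset.range T, (t k + t (k + 1)) +
            ∑ k ∈ Finset.Ico (2 * T) (4 * T), (t k + t (k + 1)) := by
            refine add_le_add ih ?_
            calc ENNReal.ofReal (2 * c₁ * (m (2 ^ n) : ℝ)⁻¹)
                = ENNReal.ofReal ((2 * T : ℕ) * (c₁ / (4 ^ n * m (2 ^ n) ^ 2))) := by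
                  congr 1
                  rw [hTdef]; push_cast; field_simp
              _ = ∑ k ∈ Finset.Ico (2 * T) (4 * T),
                    ENNReal.ofReal (c₁ / (4 ^ n * m (2 ^ n) ^ 2)) := by
                  rw [Finset.sum_const, Nat.card_Ico, nsmul_eq_mul,
                    ENNReal.ofReal_mul (Nat.cast_nonneg _), ENNReal.ofReal_natCast]
                  congr 2; omega
              _ ≤ _ := Finset.sum_le_sum fun k hk =>
                  hi₀ n hn k (Finset.mem_Ico.1 hk).1 (Finset.mem_Ico.1 hk).2
        _ ≤ ∑ k ∈ Finset.range (4 ^ (n + 1) * m (2 ^ (n + 1))), (t k + t (k + 1)) := by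
            rw [← Finset.sum_union]
            · refine Finset.sum_le_sum_of_subset fun k hk => ?_
              simp only [Finset.mem_union, Finset.mem_range, Finset.mem_Ico] at hk ⊢
              omega
            · rw [Finset.disjoint_left]
              intro k hk hk'
              simp only [Finset.mem_range, Finset.mem_Ico] at hk hk'
              omega
  have h1 := hstep n hn
  rw [Finset.sum_add_distrib] at h1
  set T := 4 ^ n * m (2 ^ n)
  have h2 : ∑ k ∈ Finset.range T, t k ≤ ∑ k ∈ Finset.range (T + 1), t k :=
    Finset.sum_le_sum_of_subset (Finset.range_mono (Nat.le_succ T))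
  have h3 : ∑ k ∈ Finset.range T, t (k + 1) ≤ ∑ k ∈ Finset.range (T + 1), t k := by
    rw [Finset.sum_range_succ']; exact le_self_add
  have h4 := h1.trans (add_le_add h2 h3)
  rw [← two_mul, mul_assoc, ENNReal.ofReal_mul zero_le_two, ENNReal.ofReal_ofNat] at h4
  exact (ENNReal.mul_le_mul_iff_right two_ne_zero ENNReal.ofNat_ne_top).1 h4

end Combs

/-! ### Profiles of the logarithmic combs. -/

section Profile

variable {α : ℝ}

theorem toothHeight_mono (hα : 0 ≤ α) {n k : ℕ} (hnk : n ≤ k) :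
    toothHeight α n ≤ toothHeight α k := by
  have h1 : max |((n : ℤ) : ℝ)| 1 ≤ max |((k : ℤ) : ℝ)| 1 := by
    refine max_le_max ?_ le_rfl
    simp only [Int.cast_natCast, Nat.abs_cast]
    exact_mod_cast hnk
  have h0 : (1 : ℝ) ≤ max |((n : ℤ) : ℝ)| 1 := le_max_right _ _
  exact Real.rpow_le_rpow (Real.log_nonneg h0) (Real.log_le_log (by linarith) h1) hα

theorem toothHeight_two_pow (i : ℕ) :
    toothHeight α ((2 ^ i : ℕ) : ℤ) = (i * Real.log 2) ^ α := by
  have : (1 : ℝ) ≤ 2 ^ i := one_le_pow₀ (by norm_num)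
  rw [toothHeight, Int.cast_natCast, Nat.abs_cast, Nat.cast_pow, Nat.cast_ofNat, max_eq_left this,
    Real.log_pow]

/-- For n ≥ 2 one has log(2n) ≤ 2 log n; the added 1 covers n ≤ 1, where log(n ∨ 1) = 0. -/
theorem toothHeight_two_mul_le (hα : 0 ≤ α) (n : ℕ) :
    toothHeight α ((2 * n : ℕ) : ℤ) ≤ 2 ^ α * toothHeight α n + 1 := by
  have h20 : (0 : ℝ) ≤ 2 ^ α := by positivity
  rcases le_or_gt n 1 with hn | hn
  · have h1 := toothHeight_mono hα (show 2 * n ≤ 2 ^ 1 by omega)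
    rw [toothHeight_two_pow, Nat.cast_one, one_mul] at h1
    have h2 : Real.log 2 ^ α ≤ 1 :=
      Real.rpow_le_one (Real.log_nonneg (by norm_num)) (by linarith [Real.log_two_lt_d9]) hα
    have h3 := mul_nonneg h20 (toothHeight_nonneg (α := α) n)
    linarith
  · have hn' : (2 : ℝ) ≤ n := by exact_mod_cast hn
    have hl2 : 0 ≤ Real.log 2 := Real.log_nonneg (by norm_num)
    have hl : Real.log 2 ≤ Real.log n := Real.log_le_log (by norm_num) hn'
    have h1 : toothHeight α n = Real.log n ^ α := by
      rw [toothHeight, Int.cast_natCast, Nat.abs_cast, max_eq_left (by linarith)]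
    have h2 : toothHeight α ((2 * n : ℕ) : ℤ) = (Real.log 2 + Real.log n) ^ α := by
      rw [toothHeight, Int.cast_natCast, Nat.abs_cast, max_eq_left (by push_cast; linarith)]
      push_cast
      rw [Real.log_mul (by norm_num) (by linarith)]
    rw [h1, h2, ← Real.mul_rpow (by norm_num) (hl2.trans hl)]
    have := Real.rpow_le_rpow (by linarith) (show Real.log 2 + Real.log n ≤ 2 * Real.log n by
      linarith) hα
    linarith

theorem tipHeight_two_pow_le (hα : 0 ≤ α) {q : ℕ} (hq : α ≤ q) (i : ℕ) :
    tipHeight α ((2 ^ i : ℕ) : ℤ) + 1 ≤ 2 * (i + 1) ^ q := by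
  have h1 : (tipHeight α ((2 ^ i : ℕ) : ℤ) : ℝ) ≤ (i * Real.log 2) ^ α := by
    rw [← toothHeight_two_pow]
    exact Nat.floor_le (toothHeight_nonneg _)
  have hi : (0 : ℝ) ≤ i := Nat.cast_nonneg i
  have hl2 : 0 ≤ Real.log 2 := Real.log_nonneg (by norm_num)
  have h2 : (i * Real.log 2) ^ α ≤ ((i : ℝ) + 1) ^ q := by
    calc (i * Real.log 2) ^ α ≤ ((i : ℝ) + 1) ^ α :=
          Real.rpow_le_rpow (by positivity) (by nlinarith [Real.log_two_lt_d9]) hα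
      _ ≤ ((i : ℝ) + 1) ^ (q : ℝ) := Real.rpow_le_rpow_of_exponent_le (by linarith) hq
      _ = _ := Real.rpow_natCast _ _
  have h3 : (1 : ℝ) ≤ ((i : ℝ) + 1) ^ q := one_le_pow₀ (by linarith)
  have : (tipHeight α ((2 ^ i : ℕ) : ℤ) : ℝ) + 1 ≤ 2 * ((i : ℝ) + 1) ^ q := by linarith
  exact_mod_cast this

theorem toothProfile_of_nonneg (hα : 0 ≤ α) :
    ToothProfile α (fun n => tipHeight α (n : ℤ) + 1) (⌈(2 : ℝ) ^ α⌉₊ + 2) where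
  mono n k hnk := Nat.add_le_add_right (Nat.floor_mono (toothHeight_mono hα hnk)) 1
  one_le n := Nat.le_add_left 1 _
  le_card n := by simp only [tipHeight_natAbs]; exact le_rfl
  card_le n := by
    simp only [tipHeight_natAbs]
    exact Nat.le_mul_of_pos_left _ (Nat.succ_pos _)
  doubling n := by
    have h1 : (tipHeight α ((2 * n : ℕ) : ℤ) : ℝ) ≤ _ := Nat.floor_le (toothHeight_nonneg _)
    have h2 := toothHeight_two_mul_le hα n
    have h3 : toothHeight α n < tipHeight α n + 1 := Nat.lt_floor_add_one _
    have h4 : ((2 : ℝ) ^ α) ≤ ⌈(2 : ℝ) ^ α⌉₊ := Nat.le_ceil _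
    have h20 : (0 : ℝ) ≤ 2 ^ α := by positivity
    have h5 : (tipHeight α ((2 * n : ℕ) : ℤ) : ℝ) ≤ ⌈(2 : ℝ) ^ α⌉₊ * (tipHeight α n + 1) + 1 := by
      have : 2 ^ α * toothHeight α n ≤ ⌈(2 : ℝ) ^ α⌉₊ * (tipHeight α n + 1) :=
        mul_le_mul h4 h3.le (toothHeight_nonneg _) (by positivity)
      linarith
    have h6 : tipHeight α ((2 * n : ℕ) : ℤ) ≤ ⌈(2 : ℝ) ^ α⌉₊ * (tipHeight α n + 1) + 1 := by
      exact_mod_cast h5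
    calc tipHeight α ((2 * n : ℕ) : ℤ) + 1
        ≤ ⌈(2 : ℝ) ^ α⌉₊ * (tipHeight α n + 1) + 2 * (tipHeight α n + 1) := by omega
      _ = _ := by ring
  growth := ⟨2, ⌈α⌉₊, fun i => tipHeight_two_pow_le hα (Nat.le_ceil α) i⟩

/-- As log 3 ≥ 1, teeth have height at most 1 for |n| ≥ 3, and height 0 for |n| ≤ 1. Only the teeth
at ±2 can be long, because log 2 < 1; D absorbs them. -/
theorem toothProfile_of_neg (hα : α < 0) :
    ToothProfile α (fun _ => 1) (tipHeight α 2 + 2) where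
  mono := monotone_const
  one_le _ := le_rfl
  le_card n := Nat.le_add_left 1 _
  card_le n := by
    rw [mul_one, ← tipHeight_natAbs n]
    generalize n.natAbs = k
    rcases lt_trichotomy k 2 with hk | rfl | hk
    · have : toothHeight α k = 0 := by
        have : max |((k : ℤ) : ℝ)| 1 = 1 := by
          rw [Int.cast_natCast, Nat.abs_cast, max_eq_right]
          exact_mod_cast (by omega : k ≤ 1)
        rw [toothHeight, this, Real.log_one, Real.zero_rpow hα.ne]
      simp [tipHeight, this]
    · simp
    · have hk' : (3 : ℝ) ≤ k := by exact_mod_cast hk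
      have h1 : toothHeight α k ≤ 1 := by
        rw [toothHeight, Int.cast_natCast, Nat.abs_cast, max_eq_left (by linarith)]
        refine Real.rpow_le_one_of_one_le_of_nonpos ?_ hα.le
        rw [Real.le_log_iff_exp_le (by linarith)]
        linarith [Real.exp_one_lt_d9]
      have h2 : tipHeight α k ≤ 1 := by
        have := Nat.floor_mono h1
        rwa [Nat.floor_one] at this
      omega
  doubling _ := by omega
  growth := ⟨1, 0, fun i => by simp⟩

/-- Every logarithmic comb has a profile; the series of its dyadic reciprocals converges for
`α > 1`, and its dyadic values grow at most linearly for `α ≤ 1`. -/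
theorem exists_toothProfile (α : ℝ) : ∃ m D, ToothProfile α m D ∧
    (1 < α → Summable fun i => (m (2 ^ i) : ℝ)⁻¹) ∧
    (α ≤ 1 → ∃ C : ℕ, 0 < C ∧ ∀ i, m (2 ^ i) ≤ C * (i + 1)) := by
  rcases lt_or_ge α 0 with hα | hα
  · exact ⟨_, _, toothProfile_of_neg hα, fun h => by linarith,
      fun _ => ⟨1, one_pos, fun i => by omega⟩⟩
  refine ⟨_, _, toothProfile_of_nonneg hα, fun h => ?_, fun h => ⟨2, two_pos, fun i => ?_⟩⟩
  · have hl2 : 0 < Real.log 2 := Real.log_pos (by norm_num)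
    have hs := (Real.summable_nat_rpow_inv.2 h).mul_left ((Real.log 2 ^ α)⁻¹)
    -- At i = 0 the comparison series has the default value 0⁻¹ = 0, so the index is shifted.
    rw [← summable_nat_add_iff 1] at hs ⊢
    refine hs.of_nonneg_of_le (fun i => by positivity) fun i => ?_
    have h1 := Nat.lt_floor_add_one (toothHeight α ((2 ^ (i + 1) : ℕ) : ℤ))
    rw [toothHeight_two_pow, Real.mul_rpow (Nat.cast_nonneg _) hl2.le] at h1
    rw [← mul_inv, mul_comm]
    refine inv_anti₀ (by positivity) ?_
    rw [Nat.cast_add, Nat.cast_one, tipHeight, toothHeight_two_pow,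
      Real.mul_rpow (Nat.cast_nonneg _) hl2.le]
    push_cast at h1 ⊢
    exact h1.le
  · have := tipHeight_two_pow_le hα (q := 1) (by simpa using h) i
    simpa using this

end Profile

/-! ### Convergence and comparison of collision sums. -/

section CollisionSums

variable {α : ℝ} {m : ℕ → ℕ} {D : ℕ}

theorem ToothProfile.tsum_tripleMass_lt_top (h : ToothProfile α m D)
    (hs : Summable fun i => (m (2 ^ i) : ℝ)⁻¹) :
    ∑' k, (logComb α).tripleMass (logCombOrigin α) (logCombOrigin α) (logCombOrigin α) k < ∞ := by
  obtain ⟨i₁, hi₁⟩ := h.eventually_mul_le_two_pow 1 1 0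
  -- From the origin, vertices reached during scale i lie within 2^(3i+4), so their teeth are
  -- shorter than 2^i.
  obtain ⟨i₂, hi₂⟩ := h.eventually_mul_le_two_pow D 3 4
  have hm : ∀ i, i₁ ≤ i → m (2 ^ i) ≤ 2 ^ i := fun i hi => by simpa using hi₁ i hi
  refine (ENNReal.tsum_le_of_sum_range_le (c := ENNReal.ofReal (18 + 57600 * (max i₁ i₂ : ℕ) +
    93312 * D * ∑' i, (m (2 ^ i) : ℝ)⁻¹)) fun N => ?_).trans_lt ENNReal.ofReal_lt_top
  refine (Finset.sum_le_sum_of_subset (Finset.range_mono ?_)).trans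
    ((h.sum_tripleMass_le (logCombOrigin α) (i₁ := max i₁ i₂) (n := N)
      (fun i hi => hm i (by omega)) fun i hi _ v hv => ?_).trans (ENNReal.ofReal_le_ofReal ?_))
  · have h1 : N < 4 ^ N := Nat.lt_pow_self (by norm_num)
    have h2 := Nat.le_mul_of_pos_right (4 ^ N) (h.one_le (2 ^ N))
    omega
  · have h1 : v.1.1.natAbs ≤ 2 ^ (3 * i + 4) := by
      calc v.1.1.natAbs ≤ 2 * (4 ^ (i + 1) * m (2 ^ (i + 1))) := by
            simpa [logCombOrigin] using hv
        _ ≤ 2 * (4 ^ (i + 1) * 2 ^ (i + 1)) := by gcongr; exact hm _ (by omega)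
        _ = 2 ^ (3 * i + 4) := by
            rw [show 4 = 2 ^ 2 by norm_num, ← pow_mul, ← pow_add, ← pow_succ']; congr 1; ring
    have h2 := h.card_le_of_le h1
    have h3 := hi₂ i (by omega)
    omega
  · gcongr
    exact hs.sum_le_tsum _ fun i _ => by positivity

theorem half_mul_le_sum_inv (l : ℕ) :
    (l / 2 : ℝ) ≤ ∑ i ∈ Finset.range (2 ^ l), ((i : ℝ) + 1)⁻¹ := by
  have h1 := log_add_one_le_harmonic (2 ^ l)
  have h2 : (l * Real.log 2 : ℝ) ≤ Real.log (((2 ^ l : ℕ) : ℝ) + 1) := by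
    rw [← Real.log_pow]
    refine Real.log_le_log (by positivity) ?_
    push_cast
    linarith
  have h3 : ((harmonic (2 ^ l) : ℚ) : ℝ) = ∑ i ∈ Finset.range (2 ^ l), ((i : ℝ) + 1)⁻¹ := by
    rw [harmonic]; push_cast; rfl
  rw [← h3]
  have := Real.log_two_gt_d9
  have hl : (0 : ℝ) ≤ l := Nat.cast_nonneg l
  push_cast at h1 h2
  nlinarith

/-- From any three starting points of equal parity, the expected number of triple collisions up
to a suitable time is at least a fixed fraction of the largest such number over all starting
points on the diagonal that can be reached. -/
theorem ToothProfile.exists_collision_ratio (h : ToothProfile α m D) {C : ℕ} (hC0 : 0 < C)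
    (hC : ∀ i, m (2 ^ i) ≤ C * (i + 1)) :
    ∃ δ : ℝ≥0∞, δ ≠ 0 ∧ ∀ a b c : LogCombVertex α, combParity a = combParity b →
      combParity b = combParity c → ∀ L : ℕ, ∃ (K : ℕ) (M : ℝ≥0∞), M ≠ 0 ∧ M ≠ ∞ ∧
        (∀ v : LogCombVertex α, v.1.1.natAbs ≤ L + K →
          ∑ j ∈ Finset.range K, (logComb α).tripleMass v v v j ≤ M) ∧
        δ * M ≤ ∑ j ∈ Finset.range K, (logComb α).tripleMass a b c j := by
  obtain ⟨c₂, hc₂, hlow⟩ := h.exists_le_sum_tripleMass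
  obtain ⟨i₁, hi₁⟩ := h.eventually_mul_le_two_pow 1 1 0
  have hm : ∀ i, i₁ ≤ i → m (2 ^ i) ≤ 2 ^ i := fun i hi => by simpa using hi₁ i hi
  set C₁ : ℝ := 1 + 115200 * C + 93312 * D with hC₁
  have hC₁0 : 0 < C₁ := by positivity
  refine ⟨ENNReal.ofReal (c₂ / (2 * C₁)), by simp; positivity, fun a b c hab hbc L => ?_⟩
  obtain ⟨i₀, hi₀⟩ := hlow a b c hab hbc
  set S : ℕ → ℝ := fun n => ∑ i ∈ Finset.range n, (m (2 ^ i) : ℝ)⁻¹ with hS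
  obtain ⟨B, hB⟩ : ∃ B, 6 * D * C ≤ 2 ^ B := ⟨6 * D * C, (Nat.lt_pow_self (by norm_num)).le⟩
  have hSl : ∀ l : ℕ, (l : ℝ) ≤ 2 * C * S (2 ^ l) := by
    intro l
    have hC' : (0 : ℝ) < C := by exact_mod_cast hC0
    have h1 := half_mul_le_sum_inv l
    have h2 : ∑ i ∈ Finset.range (2 ^ l), ((i : ℝ) + 1)⁻¹ ≤ C * S (2 ^ l) := by
      rw [hS, Finset.mul_sum]
      refine Finset.sum_le_sum fun i _ => ?_
      have hmi : (0 : ℝ) < m (2 ^ i) := by exact_mod_cast h.one_le _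
      have : (m (2 ^ i) : ℝ) ≤ C * (i + 1) := by exact_mod_cast hC i
      rw [inv_eq_one_div, ← div_eq_mul_inv, div_le_div_iff₀ (by positivity) hmi]
      linarith
    linarith
  -- l makes S(2^l), which is at least l / (2C), dominate the fixed costs and the missing initial
  -- part S(i₀).
  obtain ⟨l, hl⟩ := exists_nat_ge
    (2 * C * (18 + 57600 * ((i₁ + B : ℕ) : ℝ) + 2 * S i₀ + 1) + i₀ + i₁ + L + 1 : ℝ)
  have hS0 : 0 ≤ S i₀ := Finset.sum_nonneg fun _ _ => by positivity
  have hlS : 18 + 57600 * ((i₁ + B : ℕ) : ℝ) + 2 * S i₀ + 1 ≤ S (2 ^ l) := by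
    have hC' : (0 : ℝ) < 2 * C := by positivity
    refine le_of_mul_le_mul_left ?_ hC'
    have := hSl l
    have h0 : (0 : ℝ) ≤ (i₀ : ℝ) + i₁ + L + 1 := by positivity
    linarith
  have hll : i₀ + i₁ + L + 1 ≤ l := by
    have h0 : (0 : ℝ) ≤ 2 * C * (18 + 57600 * ((i₁ + B : ℕ) : ℝ) + 2 * S i₀ + 1) := by positivity
    exact_mod_cast (by linarith : (i₀ + i₁ + L + 1 : ℝ) ≤ l)
  have hl2 : l < 2 ^ l := Nat.lt_pow_self (by norm_num)
  set n := 2 ^ l with hn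
  set T := 4 ^ n * m (2 ^ n) with hT
  have hnT : n ≤ T :=
    (Nat.lt_pow_self (by norm_num : 1 < 4)).le.trans (Nat.le_mul_of_pos_right _ (h.one_le _))
  have hup : ∀ v : LogCombVertex α, v.1.1.natAbs ≤ L + (T + 1) →
      ∑ j ∈ Finset.range (2 * T), (logComb α).tripleMass v v v j ≤
        ENNReal.ofReal (C₁ * S n) := by
    intro v hv
    -- A diagonal start may be about T away, where teeth can have length of order n = 2^l. The sharp
    -- bound is therefore used only from scale l + O(1); the crude cost of the earlier scales is
    -- O(l), which S(n) absorbs.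
    refine (h.sum_tripleMass_le v (i₁ := i₁ + B + l) (n := n) (fun i hi => hm i (by omega))
      fun i hi hin w hw => ?_).trans (ENNReal.ofReal_le_ofReal ?_)
    · have hTi : 4 ^ (i + 1) * m (2 ^ (i + 1)) ≤ T :=
        Nat.mul_le_mul (Nat.pow_le_pow_right (by norm_num) hin)
          (h.mono (Nat.pow_le_pow_right (by norm_num) hin))
      have h1 : w.1.1.natAbs ≤ 2 ^ (3 * n + 2) := by
        calc w.1.1.natAbs ≤ 4 * T := by omega
          _ ≤ 4 * (4 ^ n * 2 ^ n) := by rw [hT]; gcongr; exact hm _ (by omega)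
          _ = 2 ^ (3 * n + 2) := by
            rw [show 4 = 2 ^ 2 by norm_num, ← pow_mul, ← pow_add, ← pow_add]; congr 1; ring
      have h2 := h.card_le_of_le h1
      have h3 : D * m (2 ^ (3 * n + 2)) ≤ 2 ^ i := by
        calc D * m (2 ^ (3 * n + 2)) ≤ D * (C * (3 * n + 2 + 1)) := Nat.mul_le_mul_left _ (hC _)
          _ ≤ D * (C * (6 * n)) := by gcongr; omega
          _ = 6 * D * C * 2 ^ l := by rw [hn]; ring
          _ ≤ 2 ^ B * 2 ^ l := Nat.mul_le_mul_right _ hB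
          _ ≤ 2 ^ i := by rw [← pow_add]; exact Nat.pow_le_pow_right (by norm_num) (by omega)
      omega
    · have := hSl l
      push_cast at hlS ⊢
      rw [hC₁]
      change _ + 93312 * (D : ℝ) * S n ≤ _
      linarith
  have hSn : 0 < S n := by
    have : (0 : ℝ) ≤ 57600 * ((i₁ + B : ℕ) : ℝ) := by positivity
    linarith
  refine ⟨T + 1, ENNReal.ofReal (C₁ * S n), by simp; positivity, ENNReal.ofReal_ne_top,
    fun v hv => ?_, ?_⟩
  · exact (Finset.sum_le_sum_of_subset (Finset.range_mono (by omega))).trans (hup v hv)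
  · refine le_trans ?_ (hi₀ n (by omega))
    rw [← ENNReal.ofReal_mul (by positivity)]
    refine ENNReal.ofReal_le_ofReal ?_
    have h1 : ∑ i ∈ Finset.Ico i₀ n, (m (2 ^ i) : ℝ)⁻¹ = S n - S i₀ := by
      rw [Finset.sum_Ico_eq_sub _ (by omega)]
    rw [h1]
    calc c₂ / (2 * C₁) * (C₁ * S n) = c₂ * (S n / 2) := by field_simp
      _ ≤ c₂ * (S n - S i₀) := by
        gcongr
        have : (0 : ℝ) ≤ 57600 * ((i₁ + B : ℕ) : ℝ) := by positivity
        linarith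

end CollisionSums

/-! ### Exit from a set by a Markov chain. -/

section MarkovChain

variable {W Ω : Type*}

/-- The probability that a chain with transition probabilities `q` stays in `D` up to time `n - 1`
and is in `A` at time `n`, as a function of its starting point. -/
noncomputable def stayThenHit (q : W → W → ℝ≥0∞) (D A : Set W) : ℕ → W → ℝ≥0∞
  | 0 => A.indicator 1
  | n + 1 => D.indicator fun s => ∑' t, q s t * stayThenHit q D A n t

/-- The Markov property for prefix events: split according to the state at time T + 1 and lengthen
the prefix by it. -/
theorem measure_prefix_inter_stayThenHit [Countable W] [MeasurableSpace W]
    [DiscreteMeasurableSpace W] [MeasurableSpace Ω] {μ : Measure Ω} {q : W → W → ℝ≥0∞}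
    {S : ℕ → Ω → W} (hS : ∀ n, Measurable (S n))
    (hq : ∀ (n : ℕ) (x : ℕ → W), μ {ω | ∀ i ≤ n + 1, S i ω = x i} =
      μ {ω | ∀ i ≤ n, S i ω = x i} * q (x n) (x (n + 1)))
    (D A : Set W) (n T : ℕ) (x : ℕ → W) :
    μ ({ω | ∀ i ≤ T, S i ω = x i} ∩ {ω | (∀ j < n, S (T + j) ω ∈ D) ∧ S (T + n) ω ∈ A}) =
      μ {ω | ∀ i ≤ T, S i ω = x i} * stayThenHit q D A n (x T) := by
  classical
  have hmeas : ∀ (T : ℕ) (x : ℕ → W), MeasurableSet {ω | ∀ i ≤ T, S i ω = x i} := by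
    intro T x
    have : {ω | ∀ i ≤ T, S i ω = x i} = ⋂ i, ⋂ (_ : i ≤ T), S i ⁻¹' {x i} := by
      ext; simp
    rw [this]
    exact MeasurableSet.iInter fun i => MeasurableSet.iInter fun _ => hS i (.of_discrete)
  have hmeas' : ∀ n T : ℕ,
      MeasurableSet {ω | (∀ j < n, S (T + j) ω ∈ D) ∧ S (T + n) ω ∈ A} := by
    intro n T
    have : {ω | (∀ j < n, S (T + j) ω ∈ D) ∧ S (T + n) ω ∈ A} =
        (⋂ j, ⋂ (_ : j < n), S (T + j) ⁻¹' D) ∩ S (T + n) ⁻¹' A := by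
      ext; simp
    rw [this]
    exact (MeasurableSet.iInter fun i => MeasurableSet.iInter fun _ => hS _ (.of_discrete)).inter
      (hS _ (.of_discrete))
  induction n generalizing T x with
  | zero =>
    by_cases hx : x T ∈ A
    · rw [stayThenHit, Set.indicator_of_mem hx, Pi.one_apply, mul_one]
      congr 1
      ext ω
      simp only [Set.mem_inter_iff, Set.mem_ofPred_eq]
      exact ⟨fun h => h.1, fun h => ⟨h, by simp, by rw [add_zero, h T le_rfl]; exact hx⟩⟩
    · rw [stayThenHit, Set.indicator_of_notMem hx, mul_zero]
      convert measure_empty (μ := μ)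
      ext ω
      simp only [Set.mem_inter_iff, Set.mem_ofPred_eq, Set.mem_empty_iff_false, iff_false]
      rintro ⟨h1, -, h2⟩
      rw [add_zero, h1 T le_rfl] at h2
      exact hx h2
  | succ n ih =>
    by_cases hx : x T ∈ D
    · have hset : {ω | ∀ i ≤ T, S i ω = x i} ∩
          {ω | (∀ j < n + 1, S (T + j) ω ∈ D) ∧ S (T + (n + 1)) ω ∈ A} =
          ⋃ t, {ω | ∀ i ≤ T + 1, S i ω = Function.update x (T + 1) t i} ∩
            {ω | (∀ j < n, S (T + 1 + j) ω ∈ D) ∧ S (T + 1 + n) ω ∈ A} := by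
        ext ω
        simp only [Set.mem_inter_iff, Set.mem_ofPred_eq, Set.mem_iUnion]
        constructor
        · rintro ⟨h1, h2, h3⟩
          refine ⟨S (T + 1) ω, fun i hi => ?_, fun j hj => ?_, ?_⟩
          · rcases Nat.lt_or_eq_of_le hi with hi' | rfl
            · rw [Function.update_of_ne (by omega)]; exact h1 i (by omega)
            · rw [Function.update_self]
          · have := h2 (j + 1) (by omega)
            rwa [show T + (j + 1) = T + 1 + j by ring] at this
          · rwa [show T + (n + 1) = T + 1 + n by ring] at h3
        · rintro ⟨t, h1, h2, h3⟩
          have h4 : ∀ i ≤ T, S i ω = x i := fun i hi => by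
            rw [h1 i (by omega), Function.update_of_ne (by omega)]
          refine ⟨h4, fun j hj => ?_, by rwa [show T + (n + 1) = T + 1 + n by ring]⟩
          rcases j with _ | j
          · rw [add_zero, h4 T le_rfl]; exact hx
          · rw [show T + (j + 1) = T + 1 + j by ring]; exact h2 j (by omega)
      rw [hset, measure_iUnion]
      · rw [stayThenHit, Set.indicator_of_mem hx, ← ENNReal.tsum_mul_left]
        refine tsum_congr fun t => ?_
        rw [ih, hq, Function.update_self, Function.update_of_ne (by omega), mul_assoc]
        congr 2
        ext ω
        simp only [Set.mem_ofPred_eq]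
        refine forall₂_congr fun i hi => ?_
        rw [Function.update_of_ne (by omega)]
      · intro s t hst
        refine Set.disjoint_left.2 fun ω hs ht => hst ?_
        have h1 := hs.1 (T + 1) le_rfl
        have h2 := ht.1 (T + 1) le_rfl
        rw [Function.update_self] at h1 h2
        rw [← h1, h2]
      · exact fun t => (hmeas _ _).inter (hmeas' _ _)
    · rw [stayThenHit, Set.indicator_of_notMem hx, mul_zero]
      convert measure_empty (μ := μ)
      ext ω
      simp only [Set.mem_inter_iff, Set.mem_ofPred_eq, Set.mem_empty_iff_false, iff_false]
      rintro ⟨h1, h2, -⟩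
      have := h2 0 (by omega)
      rw [add_zero, h1 T le_rfl] at this
      exact hx this

theorem stayThenHit_univ_antitone {q : W → W → ℝ≥0∞} (hq : ∀ s, ∑' t, q s t ≤ 1) (D : Set W)
    (s : W) : Antitone fun n => stayThenHit q D Set.univ n s := by
  refine antitone_nat_of_succ_le fun n => ?_
  induction n generalizing s with
  | zero =>
    rw [stayThenHit, stayThenHit, Set.indicator_univ, Pi.one_apply]
    refine (Set.indicator_le_self' (fun _ _ => zero_le) s).trans ?_
    simpa [stayThenHit] using hq s
  | succ n ih =>
    rw [stayThenHit, stayThenHit]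
    refine Set.indicator_le_indicator (ENNReal.tsum_le_tsum fun t => ?_)
    gcongr
    exact ih t

/-- If from every point of a closed class the chain leaves `D` before some time with probability
at least `δ`, then it leaves `D` almost surely. -/
theorem iInf_stayThenHit_eq_zero {q : W → W → ℝ≥0∞} (hq : ∀ s, ∑' t, q s t ≤ 1)
    (hfin : ∀ s, {t | q s t ≠ 0}.Finite) {D P : Set W}
    (hP : ∀ s ∈ P, ∀ t, q s t ≠ 0 → t ∈ P) {δ : ℝ≥0∞} (hδ : δ ≠ 0)
    (h : ∀ s ∈ P, ∃ n, δ + stayThenHit q D Set.univ n s ≤ 1) {s : W} (hs : s ∈ P) :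
    ⨅ n, stayThenHit q D Set.univ n s = 0 := by
  set e := stayThenHit q D Set.univ with he
  set f : W → ℝ≥0∞ := fun s => ⨅ n, e n s with hf
  set Q := ⨆ s ∈ P, f s with hQ
  have hfe : ∀ n s, f s ≤ e n s := fun n s => iInf_le _ n
  have hQ1 : Q ≤ 1 := iSup₂_le fun s _ => (hfe 0 s).trans (by simp [he, stayThenHit])
  have hfQ : ∀ s ∈ P, f s ≤ Q := fun s hs => le_iSup₂ (f := fun s _ => f s) s hs
  -- The survival probability f is subharmonic for the chain killed outside D; finitely many
  -- successors let the limit pass through the sum.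
  have hharm : ∀ s, f s ≤ D.indicator (fun s => ∑' t, q s t * f t) s := by
    intro s
    by_cases hD : s ∈ D
    · rw [Set.indicator_of_mem hD]
      have hqt : ∀ t, q s t ≠ ∞ := fun t =>
        ((ENNReal.le_tsum t).trans (hq s)).trans_lt ENNReal.one_lt_top |>.ne
      have hsum : ∀ g : W → ℝ≥0∞, ∑' t, q s t * g t = ∑ t ∈ (hfin s).toFinset, q s t * g t :=
        fun g => tsum_eq_sum fun t ht => by
          have : q s t = 0 := by simpa using ht
          rw [this, zero_mul]
      have hlim : Filter.Tendsto (fun n => ∑' t, q s t * e n t) Filter.atTop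
          (nhds (∑' t, q s t * f t)) := by
        simp only [hsum]
        refine tendsto_finsetSum _ fun t _ => ?_
        exact ENNReal.Tendsto.const_mul
          (tendsto_atTop_iInf (stayThenHit_univ_antitone hq D t)) (Or.inr (hqt t))
      refine ge_of_tendsto' hlim fun n => ?_
      have := hfe (n + 1) s
      rwa [he, stayThenHit, Set.indicator_of_mem hD] at this
    · have := hfe 1 s
      rw [Set.indicator_of_notMem hD]
      rwa [he, stayThenHit, Set.indicator_of_notMem hD] at this
  -- To survive forever the chain must survive n steps and then survive from a state of P, with
  -- chance at most Q. Taking n from the hypothesis gives Q ≤ Q(1 − δ).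
  have hbound : ∀ n, ∀ s ∈ P, f s ≤ Q * e n s := by
    intro n
    induction n with
    | zero => intro s hs; simpa [he, stayThenHit] using hfQ s hs
    | succ n ih =>
      intro s hs
      refine (hharm s).trans ?_
      by_cases hD : s ∈ D
      · rw [he, stayThenHit, Set.indicator_of_mem hD, Set.indicator_of_mem hD,
          ← ENNReal.tsum_mul_left]
        refine ENNReal.tsum_le_tsum fun t => ?_
        by_cases hqt : q s t = 0
        · simp [hqt]
        · calc q s t * f t ≤ q s t * (Q * e n t) := by gcongr; exact ih t (hP s hs t hqt)
            _ = _ := by ring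
      · rw [Set.indicator_of_notMem hD]; exact zero_le
  have hQδ : Q * δ + Q ≤ Q := by
    have hall : ∀ s ∈ P, f s ≤ Q - Q * δ := by
      intro s hs
      obtain ⟨n, hn⟩ := h s hs
      refine (hbound n s hs).trans (ENNReal.le_sub_of_add_le_left ?_ ?_)
      · refine ENNReal.mul_ne_top (hQ1.trans_lt ENNReal.one_lt_top).ne ?_
        exact ((le_self_add.trans hn).trans_lt ENNReal.one_lt_top).ne
      · rw [← mul_add]
        exact mul_le_of_le_one_right zero_le hn
    obtain ⟨n, hn⟩ := h s hs
    have h1 : Q ≤ Q - Q * δ := iSup₂_le hall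
    calc Q * δ + Q ≤ Q * δ + (Q - Q * δ) := by gcongr
      _ = Q := add_tsub_cancel_of_le (mul_le_of_le_one_right zero_le (le_self_add.trans hn))
  have hQ0 : Q = 0 := by
    have hQt : Q ≠ ∞ := (hQ1.trans_lt ENNReal.one_lt_top).ne
    have h1 : Q * δ ≤ 0 := by
      have : Q * δ + Q ≤ 0 + Q := by rwa [zero_add]
      exact (ENNReal.add_le_add_iff_right hQt).1 this
    exact (mul_eq_zero.1 (le_antisymm h1 zero_le)).resolve_right hδ
  exact le_antisymm ((hfQ s hs).trans hQ0.le) zero_le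

end MarkovChain

/-! ### The joint chain of three walks. -/

namespace SimpleGraph

variable {V : Type*} {G : SimpleGraph V} [G.LocallyFinite]

theorem trans_zero (hG : ∀ v, G.degree v ≠ 0) (a v : V) [Decidable (a = v)] :
    G.trans a 0 v = if a = v then 1 else 0 := by
  classical
  have : (G.degree a : ℝ) ≠ 0 := by exact_mod_cast hG a
  rw [trans, heat, Function.iterate_zero, id, Finsupp.single_apply]
  by_cases hav : a = v
  · subst hav; simp [this]
  · simp [hav]

theorem trans_succ (hG : ∀ v, G.degree v ≠ 0) (a v : V) (k : ℕ) :
    G.trans a (k + 1) v = ∑' w, srwStep G a w * G.trans w k v := by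
  classical
  have ha : (0 : ℝ) < G.degree a := by exact_mod_cast Nat.pos_of_ne_zero (hG a)
  rw [tsum_eq_sum (s := G.neighborFinset a) (fun w hw => by
    rw [srwStep, if_neg (by simpa using hw), zero_mul])]
  rw [trans, heat_succ_eq_sum]
  simp only [Finsupp.smul_apply, Finsupp.finsetSum_apply, smul_eq_mul]
  rw [mul_left_comm, Finset.mul_sum, Finset.mul_sum, ENNReal.ofReal_sum_of_nonneg]
  · refine Finset.sum_congr rfl fun w hw => ?_
    rw [srwStep, if_pos (by simpa using hw), ENNReal.ofReal_mul (by positivity),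
      ENNReal.ofReal_inv_of_pos ha, ENNReal.ofReal_natCast, trans]
  · intro w _
    have := heat_nonneg (G := G) w k v
    positivity

theorem tsum_srwStep (hG : ∀ v, G.degree v ≠ 0) (a : V) : ∑' w, srwStep G a w = 1 := by
  classical
  rw [tsum_eq_sum (s := G.neighborFinset a) (fun w hw => by
    rw [srwStep, if_neg (by simpa using hw)])]
  rw [Finset.sum_congr rfl fun w hw => by rw [srwStep, if_pos (by simpa using hw)],
    Finset.sum_const, G.card_neighborFinset_eq_degree, nsmul_eq_mul]
  exact ENNReal.mul_inv_cancel (by exact_mod_cast hG a) (ENNReal.natCast_ne_top _)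

theorem adj_of_srwStep_ne_zero {a w : V} (h : srwStep G a w ≠ 0) : G.Adj a w := by
  by_contra hadj
  exact h (by rw [srwStep, if_neg hadj])

theorem stayThenHit_univ_singleton (hG : ∀ v, G.degree v ≠ 0) (v : V) (n : ℕ) (a : V) :
    stayThenHit (srwStep G) Set.univ {v} n a = G.trans a n v := by
  classical
  induction n generalizing a with
  | zero => rw [stayThenHit, trans_zero hG, Set.indicator_apply]; rfl
  | succ n ih =>
    rw [stayThenHit, Set.indicator_univ, trans_succ hG]
    exact tsum_congr fun t => by rw [ih]

variable (G)

/-- The transition probabilities of three independent walks. -/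
noncomputable def tripleStep (s t : V × V × V) : ℝ≥0∞ :=
  srwStep G s.1 t.1 * srwStep G s.2.1 t.2.1 * srwStep G s.2.2 t.2.2

variable {G}

theorem tsum_triple_mul (f g h : V → ℝ≥0∞) :
    ∑' t : V × V × V, f t.1 * g t.2.1 * h t.2.2 = (∑' a, f a) * (∑' b, g b) * ∑' c, h c := by
  rw [ENNReal.tsum_prod', mul_assoc, ← ENNReal.tsum_mul_right]
  refine tsum_congr fun a => ?_
  rw [ENNReal.tsum_prod', ← ENNReal.tsum_mul_right, ← ENNReal.tsum_mul_left]
  refine tsum_congr fun b => ?_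
  rw [← ENNReal.tsum_mul_left, ← ENNReal.tsum_mul_left]
  exact tsum_congr fun c => by ring

theorem tsum_tripleStep (hG : ∀ v, G.degree v ≠ 0) (s : V × V × V) :
    ∑' t, tripleStep G s t = 1 := by
  simp only [tripleStep]
  rw [tsum_triple_mul (srwStep G s.1) (srwStep G s.2.1) (srwStep G s.2.2)]
  simp [tsum_srwStep hG]

theorem adj_of_tripleStep_ne_zero {s t : V × V × V} (h : tripleStep G s t ≠ 0) :
    G.Adj s.1 t.1 ∧ G.Adj s.2.1 t.2.1 ∧ G.Adj s.2.2 t.2.2 := by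
  have h1 := left_ne_zero_of_mul h
  exact ⟨adj_of_srwStep_ne_zero (left_ne_zero_of_mul h1),
    adj_of_srwStep_ne_zero (right_ne_zero_of_mul h1),
    adj_of_srwStep_ne_zero (right_ne_zero_of_mul h)⟩

theorem finite_tripleStep_ne_zero (s : V × V × V) : {t | tripleStep G s t ≠ 0}.Finite := by
  refine ((G.neighborFinset s.1).finite_toSet.prod ((G.neighborFinset s.2.1).finite_toSet.prod
    (G.neighborFinset s.2.2).finite_toSet)).subset fun t ht => ?_
  obtain ⟨h1, h2, h3⟩ := adj_of_tripleStep_ne_zero ht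
  simp [Set.mem_prod, h1, h2, h3]

theorem tripleMass_succ (hG : ∀ v, G.degree v ≠ 0) (s : V × V × V) (k : ℕ) :
    G.tripleMass s.1 s.2.1 s.2.2 (k + 1) =
      ∑' t, tripleStep G s t * G.tripleMass t.1 t.2.1 t.2.2 k := by
  simp only [tripleMass, ← ENNReal.tsum_mul_left]
  rw [ENNReal.tsum_comm]
  refine tsum_congr fun v => ?_
  rw [trans_succ hG, trans_succ hG, trans_succ hG, ← tsum_triple_mul]
  refine tsum_congr fun t => ?_
  rw [tripleStep]; ring

/-- The diagonal of the state space of three walks. -/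
def tripleDiag (V : Type*) : Set (V × V × V) := {s | s.1 = s.2.1 ∧ s.2.1 = s.2.2}

theorem tripleMass_zero_of_notMem (hG : ∀ v, G.degree v ≠ 0) {s : V × V × V}
    (hs : s ∉ tripleDiag V) : G.tripleMass s.1 s.2.1 s.2.2 0 = 0 := by
  classical
  refine ENNReal.tsum_eq_zero.2 fun v => ?_
  rw [trans_zero hG, trans_zero hG, trans_zero hG]
  by_cases h1 : s.1 = v
  · by_cases h2 : s.2.1 = v
    · have h3 : s.2.2 ≠ v := fun h3 => hs ⟨h1.trans h2.symm, h2.trans h3.symm⟩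
      simp [h3]
    · simp [h2]
  · simp [h1]

end SimpleGraph

/-! ### First-collision decomposition and almost sure collision. -/

section Conclusion

open SimpleGraph

variable {α : ℝ}

theorem natAbs_le_of_logComb_adj {v w : LogCombVertex α} (h : (logComb α).Adj v w) :
    w.1.1.natAbs ≤ v.1.1.natAbs + 1 := by
  rcases (logComb_adj v w).1 h with ⟨e, -⟩ | ⟨-, -, e⟩
  · rw [e]; omega
  · rcases (abs_eq zero_le_one).1 e with e | e <;> omega

/-- First-collision decomposition: the expected number of collisions is at most the probability
of a collision times the largest expected number of collisions from the diagonal. -/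
theorem sum_tripleMass_add_stayThenHit_le {R K : ℕ} {M : ℝ≥0∞}
    (hM : ∀ v : LogCombVertex α, v.1.1.natAbs ≤ R →
      ∑ j ∈ Finset.range K, (logComb α).tripleMass v v v j ≤ M) {n : ℕ} (hn : n ≤ K)
    (s : LogCombVertex α × LogCombVertex α × LogCombVertex α)
    (h1 : s.1.1.1.natAbs + n ≤ R) (h2 : s.2.1.1.1.natAbs + n ≤ R)
    (h3 : s.2.2.1.1.natAbs + n ≤ R) :
    ∑ j ∈ Finset.range n, (logComb α).tripleMass s.1 s.2.1 s.2.2 j +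
      M * stayThenHit (logComb α).tripleStep (tripleDiag (LogCombVertex α))ᶜ Set.univ n s ≤ M := by
  induction n generalizing s with
  | zero => simp [stayThenHit]
  | succ n ih =>
    -- On the diagonal the survival term vanishes and M bounds the sum. Off it the time-0 term
    -- vanishes and one step reduces n, while each distance grows by at most one, preserving the
    -- budget R.
    by_cases hs : s ∈ tripleDiag (LogCombVertex α)
    · rw [stayThenHit, Set.indicator_of_notMem (by simpa using hs), mul_zero, add_zero]
      obtain ⟨a, b, c⟩ := s
      obtain ⟨rfl, rfl⟩ : a = b ∧ b = c := hs
      exact (Finset.sum_le_sum_of_subset (Finset.range_mono hn)).trans (hM a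
        ((Nat.le_add_right _ _).trans h1))
    · rw [stayThenHit, Set.indicator_of_mem (by simpa using hs), Finset.sum_range_succ',
        tripleMass_zero_of_notMem logComb_degree_ne_zero hs, add_zero, ← ENNReal.tsum_mul_left]
      simp only [tripleMass_succ logComb_degree_ne_zero]
      rw [← Summable.tsum_finsetSum fun _ _ => ENNReal.summable, ← ENNReal.tsum_add]
      calc _ ≤ ∑' t, (logComb α).tripleStep s t * M := by
            refine ENNReal.tsum_le_tsum fun t => ?_
            rw [← Finset.mul_sum, mul_left_comm, ← mul_add]
            by_cases hst : (logComb α).tripleStep s t = 0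
            · simp [hst]
            obtain ⟨a1, a2, a3⟩ := adj_of_tripleStep_ne_zero hst
            have b1 := natAbs_le_of_logComb_adj a1
            have b2 := natAbs_le_of_logComb_adj a2
            have b3 := natAbs_le_of_logComb_adj a3
            gcongr
            exact ih (by omega) t (by omega) (by omega) (by omega)
        _ = M := by rw [ENNReal.tsum_mul_right, tsum_tripleStep logComb_degree_ne_zero, one_mul]

/-- For `α ≤ 1`, three walks on the comb started from vertices of equal parity almost surely
collide. -/
theorem iInf_stayThenHit_tripleDiag_compl (hα : α ≤ 1)
    {s : LogCombVertex α × LogCombVertex α × LogCombVertex α}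
    (hs : combParity s.1 = combParity s.2.1 ∧ combParity s.2.1 = combParity s.2.2) :
    ⨅ n, stayThenHit (logComb α).tripleStep (tripleDiag (LogCombVertex α))ᶜ Set.univ n s = 0 := by
  obtain ⟨m, D, h, -, hC⟩ := exists_toothProfile α
  obtain ⟨C, hC0, hC⟩ := hC hα
  obtain ⟨δ, hδ, hratio⟩ := h.exists_collision_ratio hC0 hC
  refine iInf_stayThenHit_eq_zero
    (P := {s | combParity s.1 = combParity s.2.1 ∧ combParity s.2.1 = combParity s.2.2})
    (fun s => (tsum_tripleStep logComb_degree_ne_zero s).le) finite_tripleStep_ne_zero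
    ?_ hδ ?_ hs
  · rintro s ⟨h1, h2⟩ t hst
    obtain ⟨a1, a2, a3⟩ := adj_of_tripleStep_ne_zero hst
    refine ⟨?_, ?_⟩
    · rw [combParity_adj _ _ a1, combParity_adj _ _ a2, h1]
    · rw [combParity_adj _ _ a2, combParity_adj _ _ a3, h2]
  · rintro s ⟨h1, h2⟩
    obtain ⟨K, M, hM0, hMt, hup, hlow⟩ := hratio s.1 s.2.1 s.2.2 h1 h2
      (s.1.1.1.natAbs + s.2.1.1.1.natAbs + s.2.2.1.1.natAbs)
    refine ⟨K, ?_⟩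
    have := sum_tripleMass_add_stayThenHit_le hup le_rfl s (by omega) (by omega) (by omega)
    -- Both expectations are proportional to M, which is finite and nonzero and cancels.
    have h3 : M * (δ + stayThenHit (logComb α).tripleStep (tripleDiag (LogCombVertex α))ᶜ
        Set.univ K s) ≤ M * 1 := by
      rw [mul_add, mul_one, mul_comm M δ]
      exact (add_le_add_left hlow _).trans this
    exact (ENNReal.mul_le_mul_iff_right hM0 hMt).1 h3

end Conclusion

/-! ### From random walks to transition probabilities. -/

section Walks

open SimpleGraph

variable {V Ω : Type*} [Countable V] [MeasurableSpace V] [DiscreteMeasurableSpace V]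
  [MeasurableSpace Ω] {G : SimpleGraph V} [G.LocallyFinite] {μ : Measure Ω}
  [IsProbabilityMeasure μ] {x₀ : V} {X Y Z : ℕ → Ω → V}

theorem IsSimpleRandomWalk.measure_eq (hG : ∀ v, G.degree v ≠ 0)
    (hX : IsSimpleRandomWalk G μ x₀ X) (n : ℕ) (v : V) :
    μ {ω | X n ω = v} = G.trans x₀ n v := by
  have h := measure_prefix_inter_stayThenHit hX.measurable hX.step Set.univ {v} n 0 fun _ => x₀
  rw [stayThenHit_univ_singleton hG] at h
  have h0 : {ω | ∀ i ≤ 0, X i ω = x₀} =ᵐ[μ] Set.univ :=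
    Filter.eventuallyEq_univ.2 (hX.start.mono fun ω hω i hi => by rwa [Nat.le_zero.1 hi])
  rw [measure_congr h0, measure_univ, one_mul] at h
  rw [← h]
  refine Eq.trans (congrArg μ ?_) (measure_congr (h0.inter (ae_eq_refl _))).symm
  ext ω
  simp

omit [Countable V] [DiscreteMeasurableSpace V] [IsProbabilityMeasure μ] in
theorem measure_inter_of_iIndepFun
    (hind : iIndepFun (β := fun _ : Fin 3 => ℕ → V)
      ![fun ω n => X n ω, fun ω n => Y n ω, fun ω n => Z n ω] μ)
    {A B C : Set (ℕ → V)} (hA : MeasurableSet A) (hB : MeasurableSet B) (hC : MeasurableSet C) :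
    μ {ω | (fun n => X n ω) ∈ A ∧ (fun n => Y n ω) ∈ B ∧ (fun n => Z n ω) ∈ C} =
      μ {ω | (fun n => X n ω) ∈ A} * μ {ω | (fun n => Y n ω) ∈ B} *
        μ {ω | (fun n => Z n ω) ∈ C} := by
  have := hind.measure_inter_preimage_eq_mul Finset.univ (sets := ![A, B, C])
    (by intro i _; fin_cases i <;> simpa)
  rw [Fin.prod_univ_three] at this
  refine Eq.trans (congrArg μ ?_) this
  ext ω
  simp [Fin.forall_fin_succ]

theorem measure_tripleCollision (hG : ∀ v, G.degree v ≠ 0)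
    (hX : IsSimpleRandomWalk G μ x₀ X) (hY : IsSimpleRandomWalk G μ x₀ Y)
    (hZ : IsSimpleRandomWalk G μ x₀ Z)
    (hind : iIndepFun (β := fun _ : Fin 3 => ℕ → V)
      ![fun ω n => X n ω, fun ω n => Y n ω, fun ω n => Z n ω] μ) (k : ℕ) :
    μ {ω | k ∈ tripleCollisions X Y Z ω} = G.tripleMass x₀ x₀ x₀ k := by
  have hset : {ω | k ∈ tripleCollisions X Y Z ω} =
      ⋃ v, {ω | X k ω = v ∧ Y k ω = v ∧ Z k ω = v} := by
    ext ω
    simp only [tripleCollisions, Set.mem_ofPred_eq, Set.mem_iUnion]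
    constructor
    · rintro ⟨h1, h2⟩
      exact ⟨Z k ω, h1.trans h2, h2, rfl⟩
    · rintro ⟨v, rfl, h2, h3⟩
      exact ⟨h2.symm, h2.trans h3.symm⟩
  have hm : ∀ v, MeasurableSet {p : ℕ → V | p k = v} := fun v =>
    (measurable_pi_apply k : Measurable fun p : ℕ → V => p k) (.of_discrete (s := {v}))
  rw [hset, measure_iUnion]
  · refine tsum_congr fun v => ?_
    have := measure_inter_of_iIndepFun hind (hm v) (hm v) (hm v)
    simp only [Set.mem_ofPred_eq] at this
    rw [this, hX.measure_eq hG, hY.measure_eq hG, hZ.measure_eq hG]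
  · intro v w hvw
    refine Set.disjoint_left.2 fun ω hv hw => hvw ?_
    rw [← hv.1, hw.1]
  · intro v
    exact (hX.measurable k (MeasurableSet.of_discrete (s := {v}))).inter
      ((hY.measurable k (MeasurableSet.of_discrete (s := {v}))).inter
        (hZ.measurable k (MeasurableSet.of_discrete (s := {v}))))

theorem measurableSet_tripleCollision (hX : ∀ n, Measurable (X n)) (hY : ∀ n, Measurable (Y n))
    (hZ : ∀ n, Measurable (Z n)) (k : ℕ) :
    MeasurableSet {ω | k ∈ tripleCollisions X Y Z ω} :=
  ((hX k).prodMk ((hY k).prodMk (hZ k)))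
    (MeasurableSet.of_discrete (s := tripleDiag V))

omit [IsProbabilityMeasure μ] in
theorem lintegral_encard_tripleCollisions (hX : ∀ n, Measurable (X n))
    (hY : ∀ n, Measurable (Y n)) (hZ : ∀ n, Measurable (Z n)) :
    ∫⁻ ω, ((tripleCollisions X Y Z ω).encard : ℝ≥0∞) ∂μ =
      ∑' k, μ {ω | k ∈ tripleCollisions X Y Z ω} := by
  have hm := measurableSet_tripleCollision hX hY hZ
  have h1 : ∀ ω, ((tripleCollisions X Y Z ω).encard : ℝ≥0∞) =
      ∑' k, {ω | k ∈ tripleCollisions X Y Z ω}.indicator 1 ω := by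
    intro ω
    rw [← ENNReal.tsum_set_one, tsum_subtype (tripleCollisions X Y Z ω) fun _ => (1 : ℝ≥0∞)]
    rfl
  simp only [h1]
  rw [lintegral_tsum fun k => (measurable_one.indicator (hm k)).aemeasurable]
  exact tsum_congr fun k => lintegral_indicator_one (hm k)

omit [Countable V] [IsProbabilityMeasure μ] in
theorem measure_triple_prefix_succ
    (hX : IsSimpleRandomWalk G μ x₀ X) (hY : IsSimpleRandomWalk G μ x₀ Y)
    (hZ : IsSimpleRandomWalk G μ x₀ Z)
    (hind : iIndepFun (β := fun _ : Fin 3 => ℕ → V)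
      ![fun ω n => X n ω, fun ω n => Y n ω, fun ω n => Z n ω] μ) (n : ℕ) (s : ℕ → V × V × V) :
    μ {ω | ∀ i ≤ n + 1, (X i ω, Y i ω, Z i ω) = s i} =
      μ {ω | ∀ i ≤ n, (X i ω, Y i ω, Z i ω) = s i} * G.tripleStep (s n) (s (n + 1)) := by
  have hm : ∀ (n : ℕ) (x : ℕ → V), MeasurableSet {p : ℕ → V | ∀ i ≤ n, p i = x i} := by
    intro n x
    have : {p : ℕ → V | ∀ i ≤ n, p i = x i} =
        ⋂ i, ⋂ (_ : i ≤ n), (fun p : ℕ → V => p i) ⁻¹' {x i} := by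
      ext; simp
    rw [this]
    exact MeasurableSet.iInter fun i => MeasurableSet.iInter fun _ =>
      measurable_pi_apply i (.of_discrete)
  have hprod : ∀ n, μ {ω | ∀ i ≤ n, (X i ω, Y i ω, Z i ω) = s i} =
      μ {ω | ∀ i ≤ n, X i ω = (s i).1} * μ {ω | ∀ i ≤ n, Y i ω = (s i).2.1} *
        μ {ω | ∀ i ≤ n, Z i ω = (s i).2.2} := by
    intro n
    have := measure_inter_of_iIndepFun hind (hm n fun i => (s i).1) (hm n fun i => (s i).2.1)
      (hm n fun i => (s i).2.2)
    simp only [Set.mem_ofPred_eq] at this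
    rw [← this]
    congr 1
    ext ω
    simp only [Set.mem_ofPred_eq, Prod.ext_iff]
    exact ⟨fun h => ⟨fun i hi => (h i hi).1, fun i hi => (h i hi).2.1, fun i hi => (h i hi).2.2⟩,
      fun h i hi => ⟨h.1 i hi, h.2.1 i hi, h.2.2 i hi⟩⟩
  rw [hprod, hprod, hX.step, hY.step, hZ.step, tripleStep]
  ring

end Walks

/-! ### Almost sure statements. -/

theorem infinite_tripleCollisions {α : ℝ} {Ω : Type*} [MeasurableSpace Ω] {μ : Measure Ω}
    [IsProbabilityMeasure μ] {X Y Z : ℕ → Ω → LogCombVertex α}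
    (hX : IsSimpleRandomWalk (logComb α) μ (logCombOrigin α) X)
    (hY : IsSimpleRandomWalk (logComb α) μ (logCombOrigin α) Y)
    (hZ : IsSimpleRandomWalk (logComb α) μ (logCombOrigin α) Z)
    (hind : iIndepFun (β := fun _ : Fin 3 => ℕ → LogCombVertex α)
      ![fun ω n => X n ω, fun ω n => Y n ω, fun ω n => Z n ω] μ) (hα : α ≤ 1) :
    ∀ᵐ ω ∂μ, (tripleCollisions X Y Z ω).Infinite := by
  set S : ℕ → Ω → LogCombVertex α × LogCombVertex α × LogCombVertex α :=
    fun n ω => (X n ω, Y n ω, Z n ω) with hS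
  have hSm : ∀ n, Measurable (S n) := fun n =>
    (hX.measurable n).prodMk ((hY.measurable n).prodMk (hZ.measurable n))
  have hstep : ∀ n (s : ℕ → _), μ {ω | ∀ i ≤ n + 1, S i ω = s i} =
      μ {ω | ∀ i ≤ n, S i ω = s i} * (logComb α).tripleStep (s n) (s (n + 1)) :=
    measure_triple_prefix_succ hX hY hZ hind
  -- The walks start at one vertex and all change colour at each step, so every prefix of positive
  -- probability ends in the class where collisions are certain.
  have hpar : ∀ T (s : ℕ → _), μ {ω | ∀ i ≤ T, S i ω = s i} ≠ 0 →
      combParity (s T).1 = combParity (s T).2.1 ∧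
        combParity (s T).2.1 = combParity (s T).2.2 := by
    intro T s
    induction T with
    | zero =>
      intro h0
      by_contra hne
      refine h0 (measure_mono_null (t := {ω | ¬ (X 0 ω = logCombOrigin α ∧
        Y 0 ω = logCombOrigin α ∧ Z 0 ω = logCombOrigin α)}) ?_ ?_)
      · rintro ω hω ⟨h1, h2, h3⟩
        refine hne ?_
        have := hω 0 le_rfl
        rw [← this]
        simp only [hS, h1, h2, h3, and_self]
      · exact ae_iff.1 (hX.start.and (hY.start.and hZ.start))
    | succ T ih =>
      intro h0
      rw [hstep] at h0
      obtain ⟨h1, h2⟩ := ih (left_ne_zero_of_mul h0)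
      obtain ⟨a1, a2, a3⟩ := SimpleGraph.adj_of_tripleStep_ne_zero (right_ne_zero_of_mul h0)
      rw [combParity_adj _ _ a1, combParity_adj _ _ a2, combParity_adj _ _ a3, h1, h2]
      exact ⟨rfl, rfl⟩
  have hnull : ∀ T, μ {ω | ∀ j, S (T + j) ω ∉ SimpleGraph.tripleDiag (LogCombVertex α)} = 0 := by
    intro T
    set N := {ω | ∀ j, S (T + j) ω ∉ SimpleGraph.tripleDiag (LogCombVertex α)}
    have hpre : ∀ s : ℕ → _, μ ({ω | ∀ i ≤ T, S i ω = s i} ∩ N) = 0 := by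
      intro s
      by_cases h0 : μ {ω | ∀ i ≤ T, S i ω = s i} = 0
      · exact measure_mono_null Set.inter_subset_left h0
      have hinf := iInf_stayThenHit_tripleDiag_compl hα (hpar T s h0)
      refine le_antisymm ?_ zero_le
      calc μ ({ω | ∀ i ≤ T, S i ω = s i} ∩ N)
          ≤ ⨅ n, stayThenHit (logComb α).tripleStep
              (SimpleGraph.tripleDiag (LogCombVertex α))ᶜ Set.univ n (s T) := by
            refine le_iInf fun n => ?_
            refine (measure_mono ?_).trans ((measure_prefix_inter_stayThenHit hSm hstep
              (SimpleGraph.tripleDiag (LogCombVertex α))ᶜ Set.univ n T s).trans_le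
                (mul_le_of_le_one_left zero_le prob_le_one))
            exact Set.inter_subset_inter_right _ fun ω hω => ⟨fun j _ => hω j, trivial⟩
        _ = 0 := hinf
    -- Prefixes are indexed by `Fin (T + 1)` so that there are only countably many; `min i T`
    -- extends them to all times.
    refine measure_mono_null (t := ⋃ p : Fin (T + 1) → _,
      {ω | ∀ i ≤ T, S i ω = (fun i : ℕ => p ⟨min i T, by omega⟩) i} ∩ N) ?_
      (measure_iUnion_null fun p => hpre _)
    intro ω hω
    refine Set.mem_iUnion.2 ⟨fun i => S i ω, fun i hi => ?_, hω⟩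
    simp [min_eq_left hi]
  have hae : ∀ᵐ ω ∂μ, ∀ T, ∃ j, S (T + j) ω ∈ SimpleGraph.tripleDiag (LogCombVertex α) := by
    rw [ae_all_iff]
    intro T
    rw [ae_iff]
    simpa using hnull T
  filter_upwards [hae] with ω hω
  refine Set.infinite_of_forall_exists_gt fun T => ?_
  obtain ⟨j, hj⟩ := hω (T + 1)
  exact ⟨T + 1 + j, hj, by omega⟩

theorem theorem1p1 (α : ℝ) {Ω : Type*} [MeasurableSpace Ω] (μ : Measure Ω)
    [IsProbabilityMeasure μ] (X Y Z : ℕ → Ω → LogCombVertex α)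
    (hX : IsSimpleRandomWalk (logComb α) μ (logCombOrigin α) X)
    (hY : IsSimpleRandomWalk (logComb α) μ (logCombOrigin α) Y)
    (hZ : IsSimpleRandomWalk (logComb α) μ (logCombOrigin α) Z)
    (hindep : iIndepFun (β := fun _ : Fin 3 => ℕ → LogCombVertex α)
      ![fun ω n => X n ω, fun ω n => Y n ω, fun ω n => Z n ω] μ) :
    (1 < α →
      (∀ᵐ ω ∂μ, (tripleCollisions X Y Z ω).Finite) ∧
      ∫⁻ ω, ((tripleCollisions X Y Z ω).encard : ℝ≥0∞) ∂μ < ∞) ∧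
    (α ≤ 1 → ∀ᵐ ω ∂μ, (tripleCollisions X Y Z ω).Infinite) := by
  refine ⟨fun hα => ?_, infinite_tripleCollisions hX hY hZ hindep⟩
  -- This sum is the expected number of collisions, and its finiteness also gives almost sure
  -- finiteness by Borel–Cantelli.
  have hsum : ∑' k, μ {ω | k ∈ tripleCollisions X Y Z ω} < ∞ := by
    obtain ⟨m, D, h, hs, -⟩ := exists_toothProfile α
    simp only [measure_tripleCollision logComb_degree_ne_zero hX hY hZ hindep]
    exact h.tsum_tripleMass_lt_top (hs hα)
  refine ⟨ae_finite_setOfPred_mem hsum.ne, ?_⟩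
  rwa [lintegral_encard_tripleCollisions hX.measurable hY.measurable hZ.measurable]
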